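/- **Definitions.** *Contexts and relations.* For a set $T$, a context over $T$ is $\Gamma=(n,S,\tau)$ with $n\in\mathbb N$, $S\subseteq T$ finite and $\tau:n\to S$. A morphism $\Gamma\to\Gamma'$ of $\mathsf{FRg}(T)$ is a function $f:n'\to n$ with $\tau\circ f=\tau'$, where $S'\subseteq S$ is required. So $\mathsf{FRg}(T)$ is the opposite of the comma category $\mathsf{FinSet}\downarrow\mathcal P_f(T)$. It is a regular category with products $\Gamma\oplus\Gamma'=(n+n',S\cup S',[\tau,\tau'])$ and terminal object $0=(0,\varnothing,!)$. Let $\mathbb F\mathsf{Rg}(T)$ be its symmetric monoidal po-category of relations: objects are contexts, the hom-poset from $\Gamma$ to $\Gamma'$ is the poset of subobjects of $\Gamma\oplus\Gamma'$, composition is composition of relations, and the monoidal structure is induced by $(\oplus,0)$. A function $F:T\to T'$ induces a strict monoidal po-functor $\overline F=\mathbb F\mathsf{Rg}(F)$, with $\overline F(n\to S)=(n\to F(S))$. *Regular calculi.* A regular calculus $(T,P)$ is a set $T$ together with an ajax po-functor $P:\mathbb F\mathsf{Rg}(T)\to\mathsf{Poset}$, i.e. a lax symmetric monoidal po-functor whose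 laxators $1\to P(0)$ and $\rho:P(\Gamma)\times P(\Gamma')\to P(\Gamma\oplus\Gamma')$ are right adjoints. A morphism $(F,F^\sharp):(T,P)\to(T',P')$ is a function $F:T\to T'$ with a monoidal natural transformation $F^\sharp:P\Rightarrow P'\circ\overline F$. Identities and composites are the evident ones. This defines the category $\mathsf{RgCalc}$. For $f:\Gamma\to\Gamma'$ in $\mathsf{FRg}(T)$ write $f_!=P(\text{graph of }f):P(\Gamma)\to P(\Gamma')$. *The syntactic category.* The po-category $\mathsf{IntRel}_P$ has as objects the pairs $(\Gamma,\varphi)$ with $\varphi\in P(\Gamma)$. Its hom-poset from $(\Gamma_1,\varphi_1)$ to $(\Gamma_2,\varphi_2)$ consists of those $\theta\in P(\Gamma_1\oplus\Gamma_2)$ with $(\pi_1)_!\theta\le\varphi_1$ and $(\pi_2)_!\theta\le\varphi_2$. The identity of $(\Gamma,\varphi)$ is $(\delta_\Gamma)_!\varphi$ with $\delta_\Gamma$ the diagonal. Composition is $$P(\Gamma_1\oplus\Gamma_2)\times P(\Gamma_2\oplus\Gamma_3)\xrightarrow{\ \rho\ }P(\Gamma_1\oplus\Gamma_2\oplus\Gamma_2\oplus\Gamma_3)\xrightarrow{\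 P(\mathrm{comp})\ }P(\Gamma_1\oplus\Gamma_3),$$ where $\mathrm{comp}$ is the relation $\{((x,y,y,z),(x,z))\}$. Let $\mathcal R_P=\mathsf{LAdj}(\mathsf{IntRel}_P)$ be the category with the same objects whose morphisms, called internal functions, are the left adjoints in $\mathsf{IntRel}_P$. *Regular categories.* Let $\mathsf{RgCat}$ be the category of regular categories and regular functors, i.e. functors that preserve finite limits and regular epimorphisms. **Theorem 8.1.** For every regular calculus $(T,P)$ the category $\mathcal R_P$ is regular. Let $(F,F^\sharp):(T,P)\to(T',P')$ be a morphism of regular calculi. Then the assignment $$(\Gamma,\varphi)\longmapsto(\overline F\,\Gamma,\;F^\sharp_\Gamma\varphi),\qquad \bigl(\theta\in P(\Gamma_1\oplus\Gamma_2)\bigr)\longmapsto F^\sharp_{\Gamma_1\oplus\Gamma_2}(\theta)\in P'(\overline F\Gamma_1\oplus\overline F\Gamma_2)$$ sends internal functions to internal functions and is a regular functor $\mathcal R_P\to\mathcal R_{P'}$. The assignment $\mathbf{syn}$ that sends $(T,P)$ to $\mathcal R_P$ and $(F,F^\sharp)$ to this regular functor preserves identities and composition, so it is a functor $\mathbf{syn}:\mathsf{RgCalc}\to\mathsf{RgCat}$.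 -/

import Mathlib

open CategoryTheory MonoidalCategory

universe u v

namespace GRL

/-! ## The free regular category on a set of types -/

/-- A context `n ⟶ S ⊆ T`: an object of the free regular category `FRg(T)`, i.e. of the opposite
of the comma category `FinSet ↓ 𝒫_f(T)`. -/
@[ext]
structure Ctx (T : Type u) where
  /-- the arity `n` -/
  arity : ℕ
  /-- the support `S`, a finite set of types -/
  supp : Finset T
  /-- the typing `τ : n ⟶ S` -/
  typ : Fin arity → T
  typ_mem : ∀ i, typ i ∈ supp

namespace Ctx

variable {T : Type u} {Γ Δ Θ Λ : Ctx T}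

/-- A morphism `Γ ⟶ Δ` of `FRg(T)`: a function `n_Δ ⟶ n_Γ` and an inclusion `S_Δ ⊆ S_Γ`,
compatible with the typings. -/
@[ext]
structure Hom (Γ Δ : Ctx T) where
  fn : Fin Δ.arity → Fin Γ.arity
  supp_le : Δ.supp ⊆ Γ.supp
  typ_fn : ∀ i, Γ.typ (fn i) = Δ.typ i

/-- The free regular category `FRg(T)`. -/
instance : Category (Ctx T) where
  Hom := Hom
  id Γ := ⟨id, subset_rfl, fun _ => rfl⟩
  comp f g := ⟨f.fn ∘ g.fn, g.supp_le.trans f.supp_le,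
    fun i => (f.typ_fn (g.fn i)).trans (g.typ_fn i)⟩

/-- The terminal object `0` of `FRg(T)`: the empty context with empty support. -/
def zero (T : Type u) : Ctx T := ⟨0, ∅, Fin.elim0, fun i => i.elim0⟩

open scoped Classical in
/-- The product `Γ ⊕ Δ = (n + n', S ∪ S', [τ, τ'])` of contexts in `FRg(T)`. -/
noncomputable def sum (Γ Δ : Ctx T) : Ctx T where
  arity := Γ.arity + Δ.arity
  supp := Γ.supp ∪ Δ.supp
  typ := Fin.append Γ.typ Δ.typ
  typ_mem i := by
    induction i using Fin.addCases with
    | left i => simp [Γ.typ_mem]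
    | right i => simp [Δ.typ_mem]

/-- The ports of `Γ` among those of `Γ ⊕ Δ`. -/
def inl (i : Fin Γ.arity) : Fin (sum Γ Δ).arity := Fin.castAdd Δ.arity i

/-- The ports of `Δ` among those of `Γ ⊕ Δ`. -/
def inr (i : Fin Δ.arity) : Fin (sum Γ Δ).arity := Fin.natAdd Γ.arity i

/-- The function on the ports of `Γ ⊕ Δ` given by functions on those of `Γ` and `Δ`. -/
def copair {α : Sort*} (a : Fin Γ.arity → α) (b : Fin Δ.arity → α) : Fin (sum Γ Δ).arity → α :=
  Fin.append a b

@[simp]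
theorem copair_inl {α : Sort*} (a : Fin Γ.arity → α) (b : Fin Δ.arity → α) (i : Fin Γ.arity) :
    copair a b (inl i) = a i := Fin.append_left a b i

@[simp]
theorem copair_inr {α : Sort*} (a : Fin Γ.arity → α) (b : Fin Δ.arity → α) (i : Fin Δ.arity) :
    copair a b (inr i) = b i := Fin.append_right a b i

theorem sumCases {p : Fin (sum Γ Δ).arity → Prop} (h₁ : ∀ i, p (inl i)) (h₂ : ∀ i, p (inr i)) :
    ∀ i, p i := fun i => Fin.addCases (motive := p) h₁ h₂ i

@[simp]
theorem sum_typ_inl (i : Fin Γ.arity) : (sum Γ Δ).typ (inl i) = Γ.typ i :=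
  Fin.append_left Γ.typ Δ.typ i

@[simp]
theorem sum_typ_inr (i : Fin Δ.arity) : (sum Γ Δ).typ (inr i) = Δ.typ i :=
  Fin.append_right Γ.typ Δ.typ i

theorem mem_supp_sum (t : T) : t ∈ (sum Γ Δ).supp ↔ t ∈ Γ.supp ∨ t ∈ Δ.supp := by
  classical
  simp [sum]

/-- The unique morphism to the terminal object. -/
def toZero (Γ : Ctx T) : Γ ⟶ zero T := Hom.mk Fin.elim0 (Finset.empty_subset _) (fun i => i.elim0)

/-- The first projection. -/
noncomputable def fst (Γ Δ : Ctx T) : sum Γ Δ ⟶ Γ :=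
  Hom.mk inl (fun t ht => (mem_supp_sum t).2 (Or.inl ht)) sum_typ_inl

/-- The second projection. -/
noncomputable def snd (Γ Δ : Ctx T) : sum Γ Δ ⟶ Δ :=
  Hom.mk inr (fun t ht => (mem_supp_sum t).2 (Or.inr ht)) sum_typ_inr

/-- The pairing `⟨f, g⟩` of two morphisms. -/
noncomputable def lift (f : Θ ⟶ Γ) (g : Θ ⟶ Δ) : Θ ⟶ sum Γ Δ :=
  Hom.mk (copair f.fn g.fn)
    (fun t ht => ((mem_supp_sum t).1 ht).elim (fun h => f.supp_le h) (fun h => g.supp_le h))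
    (sumCases (fun i => by simpa using f.typ_fn i) (fun i => by simpa using g.typ_fn i))

/-! ### Subobjects -/

/-- A subobject of `Γ` in `FRg(T)`. A morphism `m : A ⟶ Γ` is monic iff its underlying function
`n_A ⟵ n_Γ` is surjective; so a subobject of `Γ` amounts to a finite support containing that of
`Γ` and an equivalence relation on the ports of `Γ` that relates only ports of equal type
(see `mono_iff`, `exists_im_eq` and `im_le_im_iff` below). -/
@[ext]
structure SubObj (Γ : Ctx T) where
  supp : Finset T
  rel : Setoid (Fin Γ.arity)
  supp_le : Γ.supp ⊆ supp
  typ_eq : ∀ i j, rel i j → Γ.typ i = Γ.typ j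

/-- The inclusion order on subobjects: a larger support and more identifications give a smaller
subobject. -/
instance : PartialOrder (SubObj Γ) where
  le A B := B.supp ⊆ A.supp ∧ B.rel ≤ A.rel
  le_refl A := ⟨subset_rfl, le_rfl⟩
  le_trans A B C h k := ⟨k.1.trans h.1, k.2.trans h.2⟩
  le_antisymm A B h k := SubObj.ext (h.1.antisymm' k.1) (le_antisymm k.2 h.2)

/-- The image of a morphism `m : A ⟶ Γ`, as a subobject of `Γ`; if `m` is monic then this is the
subobject represented by `m`. -/
def im (m : Θ ⟶ Γ) : SubObj Γ where
  supp := Θ.supp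
  rel := Setoid.ker m.fn
  supp_le := m.supp_le
  typ_eq i j h := by
    have h : m.fn i = m.fn j := h
    rw [← m.typ_fn i, h, m.typ_fn j]

/-! ### Relations -/

/-- A relation from `Γ` to `Δ` in `FRg(T)`: a subobject of `Γ ⊕ Δ`. -/
abbrev Rel (Γ Δ : Ctx T) := SubObj (sum Γ Δ)

/-- The graph `⟨id, f⟩` of a morphism. -/
noncomputable def graph (f : Γ ⟶ Δ) : Rel Γ Δ := im (lift (𝟙 Γ) f)

/-- The cograph `⟨f, id⟩` of a morphism, the transpose of its graph. -/
noncomputable def cograph (f : Γ ⟶ Δ) : Rel Δ Γ := im (lift f (𝟙 Γ))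

/-- The equivalence relation on the ports of `Γ`, `Δ` and `Θ` that is generated by a relation
from `Γ` to `Δ` and one from `Δ` to `Θ`; it describes the pullback of the two over `Δ`. -/
def glue (A : Rel Γ Δ) (B : Rel Δ Θ) : Setoid (Fin Γ.arity ⊕ Fin Δ.arity ⊕ Fin Θ.arity) :=
  A.rel.map (copair Sum.inl (Sum.inr ∘ Sum.inl)) ⊔
    B.rel.map (copair (Sum.inr ∘ Sum.inl) (Sum.inr ∘ Sum.inr))

theorem map_le_iff {α β : Type*} (r : Setoid α) (f : α → β) (s : Setoid β) :
    r.map f ≤ s ↔ ∀ i j, r i j → s (f i) (f j) := by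
  constructor
  · intro h i j hij
    exact h (Relation.EqvGen.rel _ _ ⟨i, j, hij, rfl, rfl⟩)
  · intro h
    refine Setoid.eqvGen_le ?_
    rintro _ _ ⟨i, j, hij, rfl, rfl⟩
    exact h i j hij

theorem comp_copair {α β : Sort*} (f : α → β) (a : Fin Γ.arity → α) (b : Fin Δ.arity → α) :
    f ∘ copair a b = copair (f ∘ a) (f ∘ b) :=
  funext (sumCases (fun i => by simp) (fun i => by simp))

theorem glue_le_ker {α : Type*} (A : Rel Γ Δ) (B : Rel Δ Θ) (a : Fin Γ.arity → α)
    (b : Fin Δ.arity → α) (c : Fin Θ.arity → α)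
    (hA : ∀ i j, A.rel i j → copair a b i = copair a b j)
    (hB : ∀ i j, B.rel i j → copair b c i = copair b c j) :
    glue A B ≤ Setoid.ker (Sum.elim a (Sum.elim b c)) := by
  have h₁ : copair a b = Sum.elim a (Sum.elim b c) ∘ copair Sum.inl (Sum.inr ∘ Sum.inl) := by
    rw [comp_copair]; rfl
  have h₂ : copair b c =
      Sum.elim a (Sum.elim b c) ∘ copair (Sum.inr ∘ Sum.inl) (Sum.inr ∘ Sum.inr) := by
    rw [comp_copair]; rfl
  rw [h₁] at hA
  rw [h₂] at hB
  exact sup_le ((map_le_iff _ _ _).2 hA) ((map_le_iff _ _ _).2 hB)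

theorem Rel.mem_supp (A : Rel Γ Δ) (t : T) (h : t ∈ Γ.supp ∨ t ∈ Δ.supp) : t ∈ A.supp :=
  A.supp_le ((mem_supp_sum t).2 h)

open scoped Classical in
/-- Composition of relations: the image in `Γ ⊕ Θ` of the pullback over `Δ` (a pushout of finite
sets, and a union of supports); the image is obtained by restricting the equivalence relation
to the ports of `Γ` and `Θ`, and keeps the support. -/
noncomputable def relComp (A : Rel Γ Δ) (B : Rel Δ Θ) : Rel Γ Θ where
  supp := A.supp ∪ B.supp
  rel := (glue A B).comap (copair Sum.inl (Sum.inr ∘ Sum.inr))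
  supp_le := fun t ht => Finset.mem_union.2 <| ((mem_supp_sum t).1 ht).imp
    (fun h => A.mem_supp t (Or.inl h)) (fun h => B.mem_supp t (Or.inr h))
  typ_eq i j h := by
    have := glue_le_ker A B Γ.typ Δ.typ Θ.typ A.typ_eq B.typ_eq h
    change (Sum.elim Γ.typ (Sum.elim Δ.typ Θ.typ) ∘ _) i =
      (Sum.elim Γ.typ (Sum.elim Δ.typ Θ.typ) ∘ _) j at this
    rw [comp_copair] at this
    exact this

open scoped Classical in
/-- The product of two relations (juxtaposition): the product of the two subobjects. -/
noncomputable def relTensor {Γ Γ' Δ Δ' : Ctx T} (A : Rel Γ Δ) (B : Rel Γ' Δ') :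
    Rel (sum Γ Γ') (sum Δ Δ') where
  supp := A.supp ∪ B.supp
  rel := A.rel.map (copair (inl ∘ inl) (inr ∘ inl)) ⊔ B.rel.map (copair (inl ∘ inr) (inr ∘ inr))
  supp_le := fun t ht => by
    have hA := A.mem_supp t
    have hB := B.mem_supp t
    simp only [mem_supp_sum, Finset.mem_union] at *
    tauto
  typ_eq := by
    have key : A.rel.map (copair (inl ∘ inl) (inr ∘ inl)) ⊔
        B.rel.map (copair (inl ∘ inr) (inr ∘ inr)) ≤
        Setoid.ker (sum (sum Γ Γ') (sum Δ Δ')).typ := by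
      refine sup_le ((map_le_iff _ _ _).2 fun i j h => ?_) ((map_le_iff _ _ _).2 fun i j h => ?_)
      · have e : (sum (sum Γ Γ') (sum Δ Δ')).typ ∘ copair (inl ∘ inl) (inr ∘ inl) =
            (sum Γ Δ).typ := funext (sumCases (fun i => by simp) (fun i => by simp))
        have := A.typ_eq i j h
        rw [← e] at this
        exact this
      · have e : (sum (sum Γ Γ') (sum Δ Δ')).typ ∘ copair (inl ∘ inr) (inr ∘ inr) =
            (sum Γ' Δ').typ := funext (sumCases (fun i => by simp) (fun i => by simp))
        have := B.typ_eq i j h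
        rw [← e] at this
        exact this
    exact fun i j h => key h

/-! ### Reasoning about relations pointwise -/

/-- A valuation of the ports of `Γ` satisfies a subobject if it is constant on its equivalence
classes. -/
def SubObj.Holds (A : SubObj Γ) (a : Fin Γ.arity → Prop) : Prop := ∀ i j, A.rel i j → a i = a j

theorem SubObj.le_of_holds {A B : SubObj Γ} (h₁ : B.supp ⊆ A.supp)
    (h₂ : ∀ a, A.Holds a → B.Holds a) : A ≤ B := by
  refine ⟨h₁, fun i j hij => ?_⟩
  have := h₂ (fun k => A.rel i k)
    (fun k l hkl => propext ⟨fun h => A.rel.trans h hkl, fun h => A.rel.trans h (A.rel.symm hkl)⟩)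
    i j hij
  exact this.mp (A.rel.refl i)

theorem SubObj.ext_holds {A B : SubObj Γ} (h₁ : A.supp = B.supp)
    (h₂ : ∀ a, A.Holds a ↔ B.Holds a) : A = B :=
  le_antisymm (SubObj.le_of_holds h₁.ge fun a => (h₂ a).1)
    (SubObj.le_of_holds h₁.le fun a => (h₂ a).2)

theorem SubObj.Holds.of_le {A B : SubObj Γ} (h : A ≤ B) {a : Fin Γ.arity → Prop}
    (ha : A.Holds a) : B.Holds a := fun i j hij => ha i j (h.2 hij)

theorem holds_im (m : Θ ⟶ Γ) (a : Fin Γ.arity → Prop) :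
    (im m).Holds a ↔ ∃ b : Fin Θ.arity → Prop, a = b ∘ m.fn := by
  constructor
  · intro h
    refine ⟨fun k => ∃ i, m.fn i = k ∧ a i, funext fun i => propext ⟨fun hi => ⟨i, rfl, hi⟩, ?_⟩⟩
    rintro ⟨j, hj, haj⟩
    exact (h j i hj).mp haj
  · rintro ⟨b, rfl⟩ i j h
    have h : m.fn i = m.fn j := h
    simp [h]

theorem copair_inj {α : Sort*} {a a' : Fin Γ.arity → α} {b b' : Fin Δ.arity → α} :
    copair a b = copair a' b' ↔ a = a' ∧ b = b' := by
  constructor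
  · intro h
    refine ⟨funext fun i => ?_, funext fun i => ?_⟩
    · simpa using congrFun h (inl i)
    · simpa using congrFun h (inr i)
  · rintro ⟨rfl, rfl⟩
    rfl

theorem copair_eta {α : Sort*} (a : Fin (sum Γ Δ).arity → α) :
    copair (fun i => a (inl i)) (fun i => a (inr i)) = a :=
  funext (sumCases (fun i => by simp) (fun i => by simp))

theorem forall_copair {α : Sort*} {p : (Fin (sum Γ Δ).arity → α) → Prop} :
    (∀ a, p a) ↔ ∀ a b, p (copair a b) :=
  ⟨fun h _ _ => h _, fun h a => copair_eta a ▸ h _ _⟩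

theorem exists_copair {α : Sort*} {p : (Fin (sum Γ Δ).arity → α) → Prop} :
    (∃ a, p a) ↔ ∃ a b, p (copair a b) :=
  ⟨fun ⟨a, h⟩ => ⟨_, _, (copair_eta a).symm ▸ h⟩, fun ⟨_, _, h⟩ => ⟨_, h⟩⟩

theorem holds_graph (f : Γ ⟶ Δ) (a : Fin Γ.arity → Prop) (b : Fin Δ.arity → Prop) :
    (graph f).Holds (copair a b) ↔ b = a ∘ f.fn := by
  rw [graph, holds_im]
  change (∃ c : Fin Γ.arity → Prop, copair a b = c ∘ copair id f.fn) ↔ _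
  simp only [comp_copair, copair_inj, Function.comp_id]
  constructor
  · rintro ⟨_, rfl, h⟩
    exact h
  · exact fun h => ⟨_, rfl, h⟩

theorem holds_cograph (f : Γ ⟶ Δ) (a : Fin Γ.arity → Prop) (b : Fin Δ.arity → Prop) :
    (cograph f).Holds (copair b a) ↔ b = a ∘ f.fn := by
  rw [cograph, holds_im]
  change (∃ c : Fin Γ.arity → Prop, copair b a = c ∘ copair f.fn id) ↔ _
  simp only [comp_copair, copair_inj, Function.comp_id]
  constructor
  · rintro ⟨_, h, rfl⟩
    exact h
  · exact fun h => ⟨_, h, rfl⟩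

theorem holds_relComp (A : Rel Γ Δ) (B : Rel Δ Θ) (a : Fin Γ.arity → Prop)
    (c : Fin Θ.arity → Prop) :
    (relComp A B).Holds (copair a c) ↔
      ∃ b : Fin Δ.arity → Prop, A.Holds (copair a b) ∧ B.Holds (copair b c) := by
  constructor
  · intro h
    let f : Fin Γ.arity ⊕ Fin Δ.arity ⊕ Fin Θ.arity → Prop := fun z =>
      ∃ i, glue A B (copair Sum.inl (Sum.inr ∘ Sum.inr) i) z ∧ copair a c i
    have hf : glue A B ≤ Setoid.ker f := fun x y hxy => propext
      ⟨fun ⟨i, hi, h⟩ => ⟨i, (glue A B).trans hi hxy, h⟩,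
        fun ⟨i, hi, h⟩ => ⟨i, (glue A B).trans hi ((glue A B).symm hxy), h⟩⟩
    have h13 : f ∘ copair Sum.inl (Sum.inr ∘ Sum.inr) = copair a c := funext fun i => propext
      ⟨fun ⟨j, hj, hp⟩ => (h j i hj).mp hp, fun hp => ⟨i, (glue A B).refl _, hp⟩⟩
    rw [comp_copair] at h13
    obtain ⟨ha, hc⟩ := copair_inj.1 h13
    refine ⟨f ∘ Sum.inr ∘ Sum.inl, ?_, ?_⟩
    · rw [← ha, ← comp_copair]
      exact (map_le_iff _ _ _).1 (le_sup_left.trans hf)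
    · rw [← hc, ← comp_copair]
      exact (map_le_iff _ _ _).1 (le_sup_right.trans hf)
  · rintro ⟨b, hA, hB⟩ i j hij
    have := glue_le_ker A B a b c hA hB hij
    change (Sum.elim a (Sum.elim b c) ∘ _) i = (Sum.elim a (Sum.elim b c) ∘ _) j at this
    rw [comp_copair] at this
    exact this

theorem holds_relTensor {Γ Γ' Δ Δ' : Ctx T} (A : Rel Γ Δ) (B : Rel Γ' Δ')
    (a : Fin Γ.arity → Prop) (a' : Fin Γ'.arity → Prop) (b : Fin Δ.arity → Prop)
    (b' : Fin Δ'.arity → Prop) :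
    (relTensor A B).Holds (copair (copair a a') (copair b b')) ↔
      A.Holds (copair a b) ∧ B.Holds (copair a' b') := by
  have eL : copair (copair a a') (copair b b') ∘ copair (inl ∘ inl) (inr ∘ inl) = copair a b :=
    funext (sumCases (fun i => by simp) (fun i => by simp))
  have eR : copair (copair a a') (copair b b') ∘ copair (inl ∘ inr) (inr ∘ inr) = copair a' b' :=
    funext (sumCases (fun i => by simp) (fun i => by simp))
  have : (relTensor A B).Holds (copair (copair a a') (copair b b')) ↔
      (relTensor A B).rel ≤ Setoid.ker (copair (copair a a') (copair b b')) :=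
    ⟨fun h i j => h i j, fun h i j => @h i j⟩
  rw [this, ← eL, ← eR]
  change A.rel.map _ ⊔ B.rel.map _ ≤ _ ↔ _
  rw [sup_le_iff, map_le_iff, map_le_iff]
  rfl

@[simp]
theorem id_fn : Hom.fn (𝟙 Γ) = id := rfl

@[simp]
theorem comp_comp_fn {α : Sort*} (a : Fin Γ.arity → α) (f : Γ ⟶ Δ) (g : Δ ⟶ Θ) :
    a ∘ Hom.fn (f ≫ g) = (a ∘ f.fn) ∘ g.fn := rfl

@[simp]
theorem comp_lift_fn {α : Sort*} (a : Fin Θ.arity → α) (f : Θ ⟶ Γ) (g : Θ ⟶ Δ) :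
    a ∘ Hom.fn (lift f g) = copair (a ∘ f.fn) (a ∘ g.fn) := comp_copair _ _ _

@[simp]
theorem copair_comp_fst {α : Sort*} (a : Fin Γ.arity → α) (b : Fin Δ.arity → α) :
    copair a b ∘ Hom.fn (fst Γ Δ) = a := funext fun i => copair_inl a b i

@[simp]
theorem copair_comp_snd {α : Sort*} (a : Fin Γ.arity → α) (b : Fin Δ.arity → α) :
    copair a b ∘ Hom.fn (snd Γ Δ) = b := funext fun i => copair_inr a b i

theorem point_zero_eq {α : Sort*} (a b : Fin (zero T).arity → α) : a = b :=
  funext fun i => i.elim0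

theorem hom_ext {f g : Γ ⟶ Δ} (h : f.fn = g.fn) : f = g := Hom.ext h

theorem hom_ext_sum {f g : Θ ⟶ sum Γ Δ} (h₁ : f ≫ fst Γ Δ = g ≫ fst Γ Δ)
    (h₂ : f ≫ snd Γ Δ = g ≫ snd Γ Δ) : f = g :=
  hom_ext (funext (sumCases (congrFun (congrArg Hom.fn h₁)) (congrFun (congrArg Hom.fn h₂))))

@[simp]
theorem lift_fst (f : Θ ⟶ Γ) (g : Θ ⟶ Δ) : lift f g ≫ fst Γ Δ = f :=
  hom_ext (funext fun i => copair_inl f.fn g.fn i)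

@[simp]
theorem lift_snd (f : Θ ⟶ Γ) (g : Θ ⟶ Δ) : lift f g ≫ snd Γ Δ = g :=
  hom_ext (funext fun i => copair_inr f.fn g.fn i)

@[simp]
theorem lift_fst_assoc (f : Θ ⟶ Γ) (g : Θ ⟶ Δ) (h : Γ ⟶ Λ) :
    lift f g ≫ fst Γ Δ ≫ h = f ≫ h := by rw [← Category.assoc, lift_fst]

@[simp]
theorem lift_snd_assoc (f : Θ ⟶ Γ) (g : Θ ⟶ Δ) (h : Δ ⟶ Λ) :
    lift f g ≫ snd Γ Δ ≫ h = g ≫ h := by rw [← Category.assoc, lift_snd]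

theorem toZero_eq (f g : Γ ⟶ zero T) : f = g := hom_ext (funext fun i => i.elim0)

/-- The associativity isomorphism of the product. -/
noncomputable def assocIso (Γ Δ Θ : Ctx T) : sum (sum Γ Δ) Θ ≅ sum Γ (sum Δ Θ) where
  hom := lift (fst _ _ ≫ fst _ _) (lift (fst _ _ ≫ snd _ _) (snd _ _))
  inv := lift (lift (fst _ _) (snd _ _ ≫ fst _ _)) (snd _ _ ≫ snd _ _)
  hom_inv_id := by
    refine hom_ext_sum (hom_ext_sum ?_ ?_) ?_ <;> simp
  inv_hom_id := by
    refine hom_ext_sum ?_ (hom_ext_sum ?_ ?_) <;> simp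

/-- The left unit isomorphism of the product. -/
noncomputable def leftIso (Γ : Ctx T) : sum (zero T) Γ ≅ Γ where
  hom := snd _ _
  inv := lift (toZero Γ) (𝟙 Γ)
  hom_inv_id := hom_ext_sum (toZero_eq _ _) (by simp)
  inv_hom_id := by simp

/-- The right unit isomorphism of the product. -/
noncomputable def rightIso (Γ : Ctx T) : sum Γ (zero T) ≅ Γ where
  hom := fst _ _
  inv := lift (𝟙 Γ) (toZero Γ)
  hom_inv_id := hom_ext_sum (by simp) (toZero_eq _ _)
  inv_hom_id := by simp

/-- The symmetry isomorphism of the product. -/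
noncomputable def swapIso (Γ Δ : Ctx T) : sum Γ Δ ≅ sum Δ Γ where
  hom := lift (snd _ _) (fst _ _)
  inv := lift (snd _ _) (fst _ _)
  hom_inv_id := by refine hom_ext_sum ?_ ?_ <;> simp
  inv_hom_id := by refine hom_ext_sum ?_ ?_ <;> simp

@[simp]
theorem mem_relComp_supp (A : Rel Γ Δ) (B : Rel Δ Θ) (t : T) :
    t ∈ (relComp A B).supp ↔ t ∈ A.supp ∨ t ∈ B.supp := by
  classical
  simp [relComp]

@[simp]
theorem mem_relTensor_supp {Γ Γ' Δ Δ' : Ctx T} (A : Rel Γ Δ) (B : Rel Γ' Δ') (t : T) :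
    t ∈ (relTensor A B).supp ↔ t ∈ A.supp ∨ t ∈ B.supp := by
  classical
  simp [relTensor]

@[simp]
theorem graph_supp (f : Γ ⟶ Δ) : (graph f).supp = Γ.supp := rfl

@[simp]
theorem cograph_supp (f : Γ ⟶ Δ) : (cograph f).supp = Γ.supp := rfl

theorem not_mem_zero_supp (t : T) : t ∉ (zero T).supp := Finset.notMem_empty t

theorem id_relComp (A : Rel Γ Δ) : relComp (graph (𝟙 Γ)) A = A := by
  refine SubObj.ext_holds (Finset.ext fun t => ?_) ?_
  · have := A.mem_supp t
    simp only [mem_relComp_supp, graph_supp]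
    tauto
  · simp [forall_copair, holds_relComp, holds_graph]

theorem relComp_id (A : Rel Γ Δ) : relComp A (graph (𝟙 Δ)) = A := by
  refine SubObj.ext_holds (Finset.ext fun t => ?_) ?_
  · have := A.mem_supp t
    simp only [mem_relComp_supp, graph_supp]
    tauto
  · simp [forall_copair, holds_relComp, holds_graph]

theorem relComp_assoc (A : Rel Γ Δ) (B : Rel Δ Θ) (C : Rel Θ Λ) :
    relComp (relComp A B) C = relComp A (relComp B C) := by
  refine SubObj.ext_holds (Finset.ext fun t => ?_) ?_
  · simp only [mem_relComp_supp]
    tauto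
  · simp only [forall_copair, holds_relComp]
    intro a d
    constructor
    · rintro ⟨c, ⟨b, h₁, h₂⟩, h₃⟩
      exact ⟨b, h₁, c, h₂, h₃⟩
    · rintro ⟨b, h₁, c, h₂, h₃⟩
      exact ⟨c, ⟨b, h₁, h₂⟩, h₃⟩

theorem relComp_mono {A A' : Rel Γ Δ} {B B' : Rel Δ Θ} (hA : A ≤ A') (hB : B ≤ B') :
    relComp A B ≤ relComp A' B' := by
  refine SubObj.le_of_holds (fun t => ?_) ?_
  · have h₁ := @hA.1 t
    have h₂ := @hB.1 t
    simp only [mem_relComp_supp]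
    tauto
  · simp only [forall_copair, holds_relComp]
    rintro a c ⟨b, h₁, h₂⟩
    exact ⟨b, h₁.of_le hA, h₂.of_le hB⟩

theorem relTensor_mono {Γ Γ' Δ Δ' : Ctx T} {A A' : Rel Γ Δ} {B B' : Rel Γ' Δ'} (hA : A ≤ A')
    (hB : B ≤ B') : relTensor A B ≤ relTensor A' B' := by
  refine SubObj.le_of_holds (fun t => ?_) ?_
  · have h₁ := @hA.1 t
    have h₂ := @hB.1 t
    simp only [mem_relTensor_supp]
    tauto
  · simp only [forall_copair, holds_relTensor]
    rintro a a' b b' ⟨h₁, h₂⟩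
    exact ⟨h₁.of_le hA, h₂.of_le hB⟩

theorem graph_comp (f : Γ ⟶ Δ) (g : Δ ⟶ Θ) : graph (f ≫ g) = relComp (graph f) (graph g) := by
  refine SubObj.ext_holds (Finset.ext fun t => ?_) ?_
  · have := @f.supp_le t
    simp only [mem_relComp_supp, graph_supp]
    tauto
  · simp [forall_copair, holds_relComp, holds_graph]

theorem relTensor_id (Γ Δ : Ctx T) :
    relTensor (graph (𝟙 Γ)) (graph (𝟙 Δ)) = graph (𝟙 (sum Γ Δ)) := by
  refine SubObj.ext_holds (Finset.ext fun t => ?_) ?_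
  · simp [mem_supp_sum]
  · simp [forall_copair, holds_relTensor, holds_graph, copair_inj]

theorem relTensor_relComp {Γ Γ' Δ Δ' Θ Θ' : Ctx T} (A : Rel Γ Δ) (A' : Rel Γ' Δ') (B : Rel Δ Θ)
    (B' : Rel Δ' Θ') : relComp (relTensor A A') (relTensor B B') =
      relTensor (relComp A B) (relComp A' B') := by
  refine SubObj.ext_holds (Finset.ext fun t => ?_) ?_
  · simp only [mem_relComp_supp, mem_relTensor_supp]
    tauto
  · simp only [forall_copair, holds_relComp, holds_relTensor, exists_copair]
    intro a a' c c'
    constructor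
    · rintro ⟨b, b', ⟨h₁, h₂⟩, h₃, h₄⟩
      exact ⟨⟨b, h₁, h₃⟩, b', h₂, h₄⟩
    · rintro ⟨⟨b, h₁, h₃⟩, b', h₂, h₄⟩
      exact ⟨b, b', ⟨h₁, h₂⟩, h₃, h₄⟩

theorem rel_associator_naturality {Γ Γ' Δ Δ' Θ Θ' : Ctx T} (A : Rel Γ Γ') (B : Rel Δ Δ')
    (C : Rel Θ Θ') :
    relComp (relTensor (relTensor A B) C) (graph (assocIso Γ' Δ' Θ').hom) =
      relComp (graph (assocIso Γ Δ Θ).hom) (relTensor A (relTensor B C)) := by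
  refine SubObj.ext_holds (Finset.ext fun t => ?_) ?_
  · have h₁ := A.mem_supp t
    have h₂ := B.mem_supp t
    have h₃ := C.mem_supp t
    simp only [mem_relComp_supp, mem_relTensor_supp, graph_supp, mem_supp_sum]
    tauto
  · simp [forall_copair, holds_relComp, holds_relTensor, exists_copair, holds_graph, assocIso,
      copair_inj, and_assoc]

theorem rel_leftUnitor_naturality {Γ Γ' : Ctx T} (A : Rel Γ Γ') :
    relComp (relTensor (graph (𝟙 (zero T))) A) (graph (leftIso Γ').hom) =
      relComp (graph (leftIso Γ).hom) A := by
  refine SubObj.ext_holds (Finset.ext fun t => ?_) ?_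
  · have h₁ := A.mem_supp t
    simp only [mem_relComp_supp, mem_relTensor_supp, graph_supp, mem_supp_sum]
    tauto
  · simp [forall_copair, holds_relComp, holds_relTensor, exists_copair, holds_graph, leftIso]

theorem rel_rightUnitor_naturality {Γ Γ' : Ctx T} (A : Rel Γ Γ') :
    relComp (relTensor A (graph (𝟙 (zero T)))) (graph (rightIso Γ').hom) =
      relComp (graph (rightIso Γ).hom) A := by
  refine SubObj.ext_holds (Finset.ext fun t => ?_) ?_
  · have h₁ := A.mem_supp t
    simp only [mem_relComp_supp, mem_relTensor_supp, graph_supp, mem_supp_sum]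
    tauto
  · simp [forall_copair, holds_relComp, holds_relTensor, exists_copair, holds_graph, rightIso]

theorem rel_pentagon (Γ Δ Θ Λ : Ctx T) :
    relComp (relTensor (graph (assocIso Γ Δ Θ).hom) (graph (𝟙 Λ)))
      (relComp (graph (assocIso Γ (sum Δ Θ) Λ).hom)
        (relTensor (graph (𝟙 Γ)) (graph (assocIso Δ Θ Λ).hom))) =
      relComp (graph (assocIso (sum Γ Δ) Θ Λ).hom) (graph (assocIso Γ Δ (sum Θ Λ)).hom) := by
  refine SubObj.ext_holds (Finset.ext fun t => ?_) ?_
  · simp only [mem_relComp_supp, mem_relTensor_supp, graph_supp, mem_supp_sum]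
    tauto
  · simp [forall_copair, holds_relComp, holds_relTensor, exists_copair, holds_graph, assocIso,
      copair_inj, and_assoc]

theorem rel_triangle (Γ Δ : Ctx T) :
    relComp (graph (assocIso Γ (zero T) Δ).hom)
      (relTensor (graph (𝟙 Γ)) (graph (leftIso Δ).hom)) =
      relTensor (graph (rightIso Γ).hom) (graph (𝟙 Δ)) := by
  refine SubObj.ext_holds (Finset.ext fun t => ?_) ?_
  · simp only [mem_relComp_supp, mem_relTensor_supp, graph_supp, mem_supp_sum]
    tauto
  · simp [forall_copair, holds_relComp, holds_relTensor, holds_graph, assocIso, leftIso, rightIso]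

theorem rel_braiding_naturality {Γ Γ' Δ Δ' : Ctx T} (A : Rel Γ Γ') (B : Rel Δ Δ') :
    relComp (relTensor A B) (graph (swapIso Γ' Δ').hom) =
      relComp (graph (swapIso Γ Δ).hom) (relTensor B A) := by
  refine SubObj.ext_holds (Finset.ext fun t => ?_) ?_
  · have h₁ := A.mem_supp t
    have h₂ := B.mem_supp t
    simp only [mem_relComp_supp, mem_relTensor_supp, graph_supp, mem_supp_sum]
    tauto
  · simp [forall_copair, holds_relComp, holds_relTensor, exists_copair, holds_graph, swapIso,
      copair_inj, and_comm]

theorem rel_hexagon_forward (Γ Δ Θ : Ctx T) :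
    relComp (graph (assocIso Γ Δ Θ).hom) (relComp (graph (swapIso Γ (sum Δ Θ)).hom)
      (graph (assocIso Δ Θ Γ).hom)) =
    relComp (relTensor (graph (swapIso Γ Δ).hom) (graph (𝟙 Θ)))
      (relComp (graph (assocIso Δ Γ Θ).hom)
        (relTensor (graph (𝟙 Δ)) (graph (swapIso Γ Θ).hom))) := by
  refine SubObj.ext_holds (Finset.ext fun t => ?_) ?_
  · simp only [mem_relComp_supp, mem_relTensor_supp, graph_supp, mem_supp_sum]
    tauto
  · simp [forall_copair, holds_relComp, holds_relTensor, exists_copair, holds_graph, assocIso,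
      swapIso, copair_inj, and_assoc]
    tauto

theorem rel_hexagon_reverse (Γ Δ Θ : Ctx T) :
    relComp (graph (assocIso Γ Δ Θ).inv) (relComp (graph (swapIso (sum Γ Δ) Θ).hom)
      (graph (assocIso Θ Γ Δ).inv)) =
    relComp (relTensor (graph (𝟙 Γ)) (graph (swapIso Δ Θ).hom))
      (relComp (graph (assocIso Γ Θ Δ).inv)
        (relTensor (graph (swapIso Γ Θ).hom) (graph (𝟙 Δ)))) := by
  refine SubObj.ext_holds (Finset.ext fun t => ?_) ?_
  · simp only [mem_relComp_supp, mem_relTensor_supp, graph_supp, mem_supp_sum]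
    tauto
  · simp [forall_copair, holds_relComp, holds_relTensor, exists_copair, holds_graph, assocIso,
      swapIso, copair_inj, and_assoc]
    tauto

/-! ### Subobjects in terms of monomorphisms -/

theorem mono_iff (m : Θ ⟶ Γ) : Mono m ↔ Function.Surjective m.fn := by
  constructor
  · intro hm k
    by_contra hk
    let A : Ctx T := ⟨Θ.arity + 1, Θ.supp, Fin.snoc (α := fun _ => T) Θ.typ (Θ.typ k),
      Fin.lastCases (by simpa using Θ.typ_mem k) fun i => by simpa using Θ.typ_mem i⟩
    let f : A ⟶ Θ := Hom.mk Fin.castSucc subset_rfl fun i => by simp [A]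
    let g : A ⟶ Θ := Hom.mk (fun i => if i = k then Fin.last _ else Fin.castSucc i) subset_rfl
      fun i => by by_cases h : i = k <;> simp [A, h]
    have e : f ≫ m = g ≫ m := hom_ext <| funext fun i => by
      have : m.fn i ≠ k := fun h => hk ⟨i, h⟩
      change Fin.castSucc (m.fn i) = if m.fn i = k then Fin.last _ else Fin.castSucc (m.fn i)
      rw [if_neg this]
    have := congrFun (congrArg Hom.fn ((cancel_mono m).1 e)) k
    simp [f, g] at this
  · intro h
    refine ⟨fun f g e => hom_ext ?_⟩
    have e : f.fn ∘ m.fn = g.fn ∘ m.fn := congrArg Hom.fn e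
    exact h.injective_comp_right e

/-- The order on subobjects is the factorization order of monomorphisms. -/
theorem im_le_im_iff (m : Θ ⟶ Γ) (m' : Δ ⟶ Γ) [hm' : Mono m'] :
    im m ≤ im m' ↔ ∃ k : Θ ⟶ Δ, k ≫ m' = m := by
  constructor
  · rintro ⟨hs, hr⟩
    have hsurj := (mono_iff m').1 hm'
    have key i : m.fn (Function.surjInv hsurj (m'.fn i)) = m.fn i :=
      hr (Function.surjInv_eq hsurj (m'.fn i))
    refine ⟨Hom.mk (fun j => m.fn (Function.surjInv hsurj j)) hs fun j => ?_, hom_ext ?_⟩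
    · rw [m.typ_fn, ← m'.typ_fn, Function.surjInv_eq hsurj]
    · exact funext key
  · rintro ⟨k, rfl⟩
    exact ⟨k.supp_le, fun i j h => congrArg k.fn h⟩

/-- Every subobject is represented by a monomorphism. -/
theorem exists_im_eq (A : SubObj Γ) : ∃ (Θ : Ctx T) (m : Θ ⟶ Γ), Mono m ∧ im m = A := by
  classical
  let q := Fintype.equivFin (Quotient A.rel)
  let m : Ctx.mk (Fintype.card (Quotient A.rel)) A.supp
      (fun k => Quotient.lift Γ.typ A.typ_eq (q.symm k))
      (fun k => (q.symm k).inductionOn fun i => A.supp_le (Γ.typ_mem i)) ⟶ Γ :=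
    Hom.mk (fun i => q (Quotient.mk A.rel i)) A.supp_le fun i => by simp
  refine ⟨_, m, (mono_iff m).2 (q.surjective.comp Quotient.mk_surjective), SubObj.ext rfl ?_⟩
  ext i j
  exact q.injective.eq_iff.trans Quotient.eq

end Ctx

/-! ## Po-categories -/

/-- A po-category: a category enriched in partially ordered sets. -/
class PoCategory (C : Type u) [Category.{v} C] where
  [homOrder (X Y : C) : PartialOrder (X ⟶ Y)]
  comp_le_comp {X Y Z : C} {f f' : X ⟶ Y} {g g' : Y ⟶ Z} :
    f ≤ f' → g ≤ g' → f ≫ g ≤ f' ≫ g'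

attribute [instance] PoCategory.homOrder

/-- A monoidal po-category: the tensor product is a po-functor. -/
class MonoidalPoCategory (C : Type u) [Category.{v} C] [MonoidalCategory C] [PoCategory C] :
    Prop where
  tensor_le_tensor {X Y X' Y' : C} {f f' : X ⟶ Y} {g g' : X' ⟶ Y'} :
    f ≤ f' → g ≤ g' → f ⊗ₘ g ≤ f' ⊗ₘ g'

section PoCategory

variable {C : Type u} [Category.{v} C] [PoCategory C]

/-- An adjunction `L ⊣ R` in a po-category. The triangle identities hold automatically. -/
def IsAdj {X Y : C} (L : X ⟶ Y) (R : Y ⟶ X) : Prop := 𝟙 X ≤ L ≫ R ∧ R ≫ L ≤ 𝟙 Y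

/-- `L` is a left adjoint in a po-category. -/
def IsLeftAdj {X Y : C} (L : X ⟶ Y) : Prop := ∃ R : Y ⟶ X, IsAdj L R

/-- `R` is a right adjoint in a po-category. -/
def IsRightAdj {X Y : C} (R : Y ⟶ X) : Prop := ∃ L : X ⟶ Y, IsAdj L R

theorem isAdj_id (X : C) : IsAdj (𝟙 X) (𝟙 X) := by simp [IsAdj]

theorem IsAdj.comp {X Y Z : C} {L : X ⟶ Y} {R : Y ⟶ X} {L' : Y ⟶ Z} {R' : Z ⟶ Y}
    (h : IsAdj L R) (h' : IsAdj L' R') : IsAdj (L ≫ L') (R' ≫ R) := by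
  constructor
  · calc 𝟙 X ≤ L ≫ R := h.1
      _ = L ≫ 𝟙 Y ≫ R := by simp
      _ ≤ L ≫ (L' ≫ R') ≫ R :=
        PoCategory.comp_le_comp le_rfl (PoCategory.comp_le_comp h'.1 le_rfl)
      _ = (L ≫ L') ≫ R' ≫ R := by simp
  · calc (R' ≫ R) ≫ L ≫ L' = R' ≫ (R ≫ L) ≫ L' := by simp
      _ ≤ R' ≫ 𝟙 Y ≫ L' := PoCategory.comp_le_comp le_rfl (PoCategory.comp_le_comp h.2 le_rfl)
      _ = R' ≫ L' := by simp
      _ ≤ 𝟙 Z := h'.2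

end PoCategory

/-- The category `LAdj(C)` of left adjoints in a po-category `C`: same objects, and the left
adjoints of `C` as morphisms. -/
structure LAdj (C : Type u) where
  obj : C

instance {C : Type u} [Category.{v} C] [PoCategory C] : Category (LAdj C) where
  Hom X Y := { f : X.obj ⟶ Y.obj // IsLeftAdj f }
  id X := ⟨𝟙 X.obj, 𝟙 X.obj, isAdj_id X.obj⟩
  comp f g := ⟨f.1 ≫ g.1, g.2.choose ≫ f.2.choose, f.2.choose_spec.comp g.2.choose_spec⟩
  id_comp f := Subtype.ext (Category.id_comp f.1)
  comp_id f := Subtype.ext (Category.comp_id f.1)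
  assoc f g h := Subtype.ext (Category.assoc f.1 g.1 h.1)

/-! ### The po-category of posets -/

instance : PoCategory PartOrd.{v} where
  homOrder X Y := PartialOrder.lift (fun f : X ⟶ Y => f.hom) (fun _ _ => PartOrd.hom_ext)
  comp_le_comp {_ _ _ _ f' g _} hf hg := fun x =>
    (g.hom.monotone (hf x)).trans (hg (f'.hom x))

theorem partOrd_le_iff {X Y : PartOrd.{v}} (f g : X ⟶ Y) : f ≤ g ↔ ∀ x, f.hom x ≤ g.hom x :=
  Iff.rfl

/-- The monoidal structure on posets: cartesian product and the one-point poset. -/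
instance : CartesianMonoidalCategory PartOrd.{v} :=
  .ofChosenFiniteProducts
    { cone := Limits.asEmptyCone (PartOrd.of PUnit.{v + 1})
      isLimit := Limits.IsTerminal.ofUniqueHom
        (fun _ => PartOrd.ofHom ⟨fun _ => PUnit.unit, fun _ _ _ => le_rfl⟩) (fun _ _ => rfl) }
    (fun X Y =>
      { cone := Limits.BinaryFan.mk (P := PartOrd.of (X × Y)) (PartOrd.ofHom OrderHom.fst)
          (PartOrd.ofHom OrderHom.snd)
        isLimit := Limits.BinaryFan.IsLimit.mk _
          (fun f g => PartOrd.ofHom (OrderHom.prod f.hom g.hom)) (fun _ _ => rfl) (fun _ _ => rfl)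
          (fun f g m h₁ h₂ => by
            subst h₁ h₂
            rfl) })

instance : BraidedCategory PartOrd.{v} := BraidedCategory.ofCartesianMonoidalCategory

theorem partOrd_tensorHom_apply {X Y X' Y' : PartOrd.{v}} (f : X ⟶ Y) (g : X' ⟶ Y') (x : X)
    (x' : X') : (f ⊗ₘ g).hom (x, x') = (f.hom x, g.hom x') := rfl

theorem partOrd_whiskerLeft_apply {X X' Y' : PartOrd.{v}} (g : X' ⟶ Y') (x : X)
    (x' : X') : (X ◁ g).hom (x, x') = (x, g.hom x') := rfl

theorem partOrd_whiskerRight_apply {X Y X' : PartOrd.{v}} (f : X ⟶ Y) (x : X)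
    (x' : X') : (f ▷ X').hom (x, x') = (f.hom x, x') := rfl

theorem partOrd_associator_apply {X Y Z : PartOrd.{v}} (x : X) (y : Y) (z : Z) :
    (α_ X Y Z).hom.hom ((x, y), z) = (x, y, z) := rfl

theorem partOrd_braiding_apply {X Y : PartOrd.{v}} (x : X) (y : Y) :
    (β_ X Y).hom.hom (x, y) = (y, x) := rfl

instance : MonoidalPoCategory PartOrd.{v} where
  tensor_le_tensor hf hg := fun x => ⟨hf x.1, hg x.2⟩

/-! ### The free regular po-category -/

/-- The free regular po-category `𝔽Rg(T)`, the relations po-category of `FRg(T)`: its objects are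
the contexts, and its hom-posets are the posets of relations between contexts. -/
@[ext]
structure RelCtx (T : Type u) where
  ctx : Ctx T

namespace RelCtx

variable {T : Type u}

noncomputable instance : Category (RelCtx T) where
  Hom X Y := Ctx.Rel X.ctx Y.ctx
  id X := Ctx.graph (𝟙 X.ctx)
  comp A B := Ctx.relComp A B
  id_comp := Ctx.id_relComp
  comp_id := Ctx.relComp_id
  assoc := Ctx.relComp_assoc

noncomputable instance : PoCategory (RelCtx T) where
  homOrder X Y := inferInstanceAs (PartialOrder (Ctx.Rel X.ctx Y.ctx))
  comp_le_comp := Ctx.relComp_mono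

/-- The identity-on-objects functor `FRg(T) ⟶ 𝔽Rg(T)` that sends a morphism to its graph. -/
noncomputable def graphFunctor (T : Type u) : Ctx T ⥤ RelCtx T where
  obj Γ := ⟨Γ⟩
  map f := Ctx.graph f
  map_id _ := rfl
  map_comp := Ctx.graph_comp

/-- The tensor product of `𝔽Rg(T)`, induced by the product of `FRg(T)`. -/
noncomputable instance : MonoidalCategoryStruct (RelCtx T) where
  tensorObj X Y := ⟨Ctx.sum X.ctx Y.ctx⟩
  tensorHom A B := Ctx.relTensor A B
  whiskerLeft X _ _ A := Ctx.relTensor (Ctx.graph (𝟙 X.ctx)) A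
  whiskerRight A Y := Ctx.relTensor A (Ctx.graph (𝟙 Y.ctx))
  tensorUnit := ⟨Ctx.zero T⟩
  associator X Y Z := (graphFunctor T).mapIso (Ctx.assocIso X.ctx Y.ctx Z.ctx)
  leftUnitor X := (graphFunctor T).mapIso (Ctx.leftIso X.ctx)
  rightUnitor X := (graphFunctor T).mapIso (Ctx.rightIso X.ctx)

noncomputable instance : MonoidalCategory (RelCtx T) :=
  .ofTensorHom
    (id_tensorHom_id := fun X Y => Ctx.relTensor_id X.ctx Y.ctx)
    (id_tensorHom := fun _ _ _ _ => rfl)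
    (tensorHom_id := fun _ _ => rfl)
    (tensorHom_comp_tensorHom := fun A A' B B' => Ctx.relTensor_relComp A A' B B')
    (associator_naturality := fun A B C => Ctx.rel_associator_naturality A B C)
    (leftUnitor_naturality := fun A => Ctx.rel_leftUnitor_naturality A)
    (rightUnitor_naturality := fun A => Ctx.rel_rightUnitor_naturality A)
    (pentagon := fun W X Y Z => Ctx.rel_pentagon W.ctx X.ctx Y.ctx Z.ctx)
    (triangle := fun X Y => Ctx.rel_triangle X.ctx Y.ctx)

instance : MonoidalPoCategory (RelCtx T) where
  tensor_le_tensor := Ctx.relTensor_mono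

noncomputable instance : SymmetricCategory (RelCtx T) where
  braiding X Y := (graphFunctor T).mapIso (Ctx.swapIso X.ctx Y.ctx)
  braiding_naturality_right X _ _ A :=
    Ctx.rel_braiding_naturality (Ctx.graph (𝟙 X.ctx)) A
  braiding_naturality_left A Z :=
    Ctx.rel_braiding_naturality A (Ctx.graph (𝟙 Z.ctx))
  hexagon_forward X Y Z := Ctx.rel_hexagon_forward X.ctx Y.ctx Z.ctx
  hexagon_reverse X Y Z := Ctx.rel_hexagon_reverse X.ctx Y.ctx Z.ctx
  symmetry X Y := ((graphFunctor T).mapIso (Ctx.swapIso X.ctx Y.ctx)).hom_inv_id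

end RelCtx

/-! ### Change of types -/

namespace Ctx

variable {T T' : Type u} {Γ Δ Θ : Ctx T}

open scoped Classical in
/-- The action of `FRg(F)` on contexts: `(n ⟶ S ⊆ T)` is sent to `(n ⟶ F(S) ⊆ T')`. -/
noncomputable def map (F : T → T') (Γ : Ctx T) : Ctx T' where
  arity := Γ.arity
  supp := Γ.supp.image F
  typ := F ∘ Γ.typ
  typ_mem i := Finset.mem_image_of_mem F (Γ.typ_mem i)

theorem mem_map_supp (F : T → T') (Γ : Ctx T) (t : T') :
    t ∈ (map F Γ).supp ↔ ∃ s ∈ Γ.supp, F s = t := by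
  classical
  simp [map]

open scoped Classical in
/-- The action on relations of the relations po-functor `𝔽Rg(F)` of `FRg(F)`. -/
noncomputable def relMap (F : T → T') (A : Rel Γ Δ) : Rel (map F Γ) (map F Δ) where
  supp := A.supp.image F
  rel := A.rel
  supp_le t ht := by
    have := A.supp_le
    simp only [mem_supp_sum, mem_map_supp, Finset.mem_image] at *
    rcases ht with ⟨s, hs, rfl⟩ | ⟨s, hs, rfl⟩
    · exact ⟨s, A.mem_supp s (Or.inl hs), rfl⟩
    · exact ⟨s, A.mem_supp s (Or.inr hs), rfl⟩
  typ_eq i j h := by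
    have e : (sum (map F Γ) (map F Δ)).typ = F ∘ (sum Γ Δ).typ := (comp_copair F Γ.typ Δ.typ).symm
    rw [e]
    exact congrArg F (A.typ_eq i j h)

@[simp]
theorem mem_relMap_supp (F : T → T') (A : Rel Γ Δ) (t : T') :
    t ∈ (relMap F A).supp ↔ ∃ s ∈ A.supp, F s = t := by
  classical
  simp [relMap]

theorem map_zero (F : T → T') : map F (zero T) = zero T' := by
  classical
  refine Ctx.ext rfl ?_ (heq_of_eq (funext fun i => i.elim0))
  simp [map, zero]

theorem map_sum (F : T → T') (Γ Δ : Ctx T) : map F (sum Γ Δ) = sum (map F Γ) (map F Δ) := by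
  classical
  refine Ctx.ext rfl ?_ (heq_of_eq (comp_copair F Γ.typ Δ.typ))
  simp [map, sum, Finset.image_union]

theorem map_id (Γ : Ctx T) : map id Γ = Γ := by
  classical
  refine Ctx.ext rfl ?_ HEq.rfl
  simp [map]

theorem map_map {T'' : Type u} (F : T → T') (G : T' → T'') (Γ : Ctx T) :
    map G (map F Γ) = map (G ∘ F) Γ := by
  classical
  refine Ctx.ext rfl ?_ HEq.rfl
  simp [map, Finset.image_image]

theorem relMap_relComp (F : T → T') (A : Rel Γ Δ) (B : Rel Δ Θ) :
    relMap F (relComp A B) = relComp (relMap F A) (relMap F B) := by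
  refine SubObj.ext (Finset.ext fun t => ?_) rfl
  simp only [mem_relMap_supp, mem_relComp_supp]
  grind

end Ctx

namespace RelCtx

variable {T T' : Type u}

theorem eqToHom_square {X X' Y Y' : RelCtx T} (h : X = X') (k : Y = Y')
    (A : X ⟶ Y) (B : X' ⟶ Y') (hs : ∀ t, t ∈ Ctx.SubObj.supp A ↔ t ∈ Ctx.SubObj.supp B)
    (hr : ∀ i j, Ctx.SubObj.rel A i j ↔
      Ctx.SubObj.rel B (Fin.cast (by rw [h, k]) i) (Fin.cast (by rw [h, k]) j)) :
    A ≫ eqToHom k = eqToHom h ≫ B := by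
  subst h k
  rw [eqToHom_refl, eqToHom_refl, Category.comp_id, Category.id_comp]
  exact Ctx.SubObj.ext (Finset.ext hs) (Setoid.ext hr)

/-- The po-functor `𝔽Rg(F) : 𝔽Rg(T) ⟶ 𝔽Rg(T')` induced by a function `F : T ⟶ T'`. -/
noncomputable def mapFunctor (F : T → T') : RelCtx T ⥤ RelCtx T' where
  obj X := ⟨Ctx.map F X.ctx⟩
  map A := Ctx.relMap F A
  map_id X := by
    refine Ctx.SubObj.ext rfl ?_
    rfl
  map_comp := Ctx.relMap_relComp F

theorem mapFunctor_unit (F : T → T') : 𝟙_ (RelCtx T') = (mapFunctor F).obj (𝟙_ (RelCtx T)) :=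
  RelCtx.ext (Ctx.map_zero F).symm

theorem mapFunctor_tensor (F : T → T') (X Y : RelCtx T) :
    (mapFunctor F).obj X ⊗ (mapFunctor F).obj Y = (mapFunctor F).obj (X ⊗ Y) :=
  RelCtx.ext (Ctx.map_sum F X.ctx Y.ctx).symm

theorem mapFunctor_id (X : RelCtx T) : X = (mapFunctor id).obj X :=
  RelCtx.ext (Ctx.map_id X.ctx).symm

theorem mapFunctor_comp {T'' : Type u} (F : T → T') (G : T' → T'') (X : RelCtx T) :
    (mapFunctor G).obj ((mapFunctor F).obj X) = (mapFunctor (G ∘ F)).obj X :=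
  RelCtx.ext (Ctx.map_map F G X.ctx)

theorem mapFunctor_id_map {X Y : RelCtx T} (A : X ⟶ Y) :
    A ≫ eqToHom (mapFunctor_id Y) = eqToHom (mapFunctor_id X) ≫ (mapFunctor id).map A :=
  eqToHom_square _ _ _ _ (fun t => by
    change _ ↔ t ∈ (Ctx.relMap id A).supp
    simp) (fun _ _ => Iff.rfl)

theorem mapFunctor_comp_map {T'' : Type u} (F : T → T') (G : T' → T'') {X Y : RelCtx T}
    (A : X ⟶ Y) :
    (mapFunctor G).map ((mapFunctor F).map A) ≫ eqToHom (mapFunctor_comp F G Y) =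
      eqToHom (mapFunctor_comp F G X) ≫ (mapFunctor (G ∘ F)).map A :=
  eqToHom_square _ _ _ _ (fun t => by
    change t ∈ (Ctx.relMap G (Ctx.relMap F A)).supp ↔ t ∈ (Ctx.relMap (G ∘ F) A).supp
    simp) (fun _ _ => Iff.rfl)

/-- The strict monoidal structure on `𝔽Rg(F)`: its structure maps are equalities of contexts. -/
noncomputable def mapMonoidal (F : T → T') : (mapFunctor F).CoreMonoidal where
  εIso := eqToIso (mapFunctor_unit F)
  μIso X Y := eqToIso (mapFunctor_tensor F X Y)
  μIso_hom_natural_left {X Y} A Z := by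
    refine eqToHom_square (mapFunctor_tensor F X Z) (mapFunctor_tensor F Y Z) _ _
      (fun t => ?_) (fun _ _ => Iff.rfl)
    change t ∈ (Ctx.relTensor (Ctx.relMap F A) (Ctx.graph (𝟙 (Ctx.map F Z.ctx)))).supp ↔
      t ∈ (Ctx.relMap F (Ctx.relTensor A (Ctx.graph (𝟙 Z.ctx)))).supp
    simp only [Ctx.mem_relTensor_supp, Ctx.mem_relMap_supp, Ctx.graph_supp, Ctx.mem_map_supp]
    grind
  μIso_hom_natural_right {X Y} Z A := by
    refine eqToHom_square (mapFunctor_tensor F Z X) (mapFunctor_tensor F Z Y) _ _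
      (fun t => ?_) (fun _ _ => Iff.rfl)
    change t ∈ (Ctx.relTensor (Ctx.graph (𝟙 (Ctx.map F Z.ctx))) (Ctx.relMap F A)).supp ↔
      t ∈ (Ctx.relMap F (Ctx.relTensor (Ctx.graph (𝟙 Z.ctx)) A)).supp
    simp only [Ctx.mem_relTensor_supp, Ctx.mem_relMap_supp, Ctx.graph_supp, Ctx.mem_map_supp]
    grind
  associativity X Y Z := by
    simp only [eqToIso.hom, eqToHom_whiskerRight, whiskerLeft_eqToHom, eqToHom_trans_assoc,
      eqToHom_trans]
    refine (eqToHom_square _ _ (α_ _ _ _).hom ((mapFunctor F).map (α_ X Y Z).hom)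
      (fun t => ?_) (fun _ _ => Iff.rfl)).symm
    change t ∈ (Ctx.sum (Ctx.sum (Ctx.map F X.ctx) (Ctx.map F Y.ctx)) (Ctx.map F Z.ctx)).supp ↔
      t ∈ (Ctx.map F (Ctx.sum (Ctx.sum X.ctx Y.ctx) Z.ctx)).supp
    simp only [Ctx.map_sum]
  left_unitality X := by
    simp only [eqToIso.hom, eqToHom_whiskerRight, eqToHom_trans_assoc]
    rw [← eqToHom_square (k := rfl), eqToHom_refl, Category.comp_id]
    · exact fun t => by
        change t ∈ (Ctx.sum (Ctx.zero T') (Ctx.map F X.ctx)).supp ↔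
          t ∈ (Ctx.map F (Ctx.sum (Ctx.zero T) X.ctx)).supp
        simp only [Ctx.map_sum, Ctx.map_zero]
    · exact fun _ _ => Iff.rfl
  right_unitality X := by
    simp only [eqToIso.hom, whiskerLeft_eqToHom, eqToHom_trans_assoc]
    rw [← eqToHom_square (k := rfl), eqToHom_refl, Category.comp_id]
    · exact fun t => by
        change t ∈ (Ctx.sum (Ctx.map F X.ctx) (Ctx.zero T')).supp ↔
          t ∈ (Ctx.map F (Ctx.sum X.ctx (Ctx.zero T))).supp
        simp only [Ctx.map_sum, Ctx.map_zero]
    · exact fun _ _ => Iff.rfl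

noncomputable instance (F : T → T') : (mapFunctor F).Monoidal := (mapMonoidal F).toMonoidal

theorem mapFunctor_ε (F : T → T') :
    Functor.LaxMonoidal.ε (mapFunctor F) = eqToHom (mapFunctor_unit F) := rfl

theorem mapFunctor_μ (F : T → T') (X Y : RelCtx T) :
    Functor.LaxMonoidal.μ (mapFunctor F) X Y = eqToHom (mapFunctor_tensor F X Y) := rfl

end RelCtx

/-! ## Regular calculi -/

/-- A lax monoidal functor between monoidal po-categories is *ajax* (adjoint-lax) if it is a
po-functor and its laxators are right adjoints. -/
class IsAjax {C : Type*} [Category C] [MonoidalCategory C] [PoCategory C] {D : Type*} [Category D]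
    [MonoidalCategory D] [PoCategory D] (F : C ⥤ D) [F.LaxMonoidal] : Prop where
  map_mono {X Y : C} {f g : X ⟶ Y} : f ≤ g → F.map f ≤ F.map g
  unit_isRightAdj : IsRightAdj (Functor.LaxMonoidal.ε F)
  tensor_isRightAdj (X Y : C) : IsRightAdj (Functor.LaxMonoidal.μ F X Y)

/-- A regular calculus `(T, P)`: a set of types `T` and an ajax (symmetric) po-functor
`P : 𝔽Rg(T) ⟶ Poset`. -/
structure RgCalc where
  T : Type u
  P : RelCtx T ⥤ PartOrd.{v}
  [laxBraided : P.LaxBraided]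
  [isAjax : IsAjax P]

namespace RgCalc

attribute [instance] laxBraided isAjax

/-- A morphism of regular calculi `(F, F♯) : (T, P) ⟶ (T', P')`: a function `F : T ⟶ T'` and a
monoidal natural transformation `F♯ : P ⟶ P' ∘ 𝔽Rg(F)`. -/
structure Hom (C D : RgCalc.{u, v}) where
  fn : C.T → D.T
  nat : C.P ⟶ RelCtx.mapFunctor fn ⋙ D.P
  [isMonoidal : NatTrans.IsMonoidal nat]

attribute [instance] Hom.isMonoidal

theorem Hom.ext_heq {C D : RgCalc.{u, v}} {f g : Hom C D} (h : f.fn = g.fn)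
    (h' : ∀ X, HEq (f.nat.app X) (g.nat.app X)) : f = g := by
  obtain ⟨f, n⟩ := f
  obtain ⟨g, n'⟩ := g
  obtain rfl : f = g := h
  obtain rfl : n = n' := by
    ext X : 2
    exact eq_of_heq (h' X)
  rfl

open Functor.LaxMonoidal

variable {C D E : RgCalc.{u, v}}

/-- Laxators commute with transport along equalities of contexts. -/
theorem map_eqToHom_μ (D : RgCalc.{u, v}) {X X' Y Y' : RelCtx D.T} (h : X = X') (k : Y = Y')
    (e : X ⊗ Y = X' ⊗ Y') :
    (D.P.map (eqToHom h) ⊗ₘ D.P.map (eqToHom k)) ≫ μ D.P X' Y' =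
      μ D.P X Y ≫ D.P.map (eqToHom e) := by
  subst h k
  simp

noncomputable def idHom (C : RgCalc.{u, v}) : Hom C C where
  fn := id
  nat :=
    { app X := C.P.map (eqToHom (RelCtx.mapFunctor_id X))
      naturality X Y A := by
        rw [Functor.comp_map, ← Functor.map_comp, ← Functor.map_comp, RelCtx.mapFunctor_id_map] }
  isMonoidal :=
    { unit := by
        rw [Functor.LaxMonoidal.comp_ε, RelCtx.mapFunctor_ε]
      tensor X Y := by
        rw [Functor.LaxMonoidal.comp_μ, RelCtx.mapFunctor_μ]
        dsimp only
        rw [← Category.assoc, map_eqToHom_μ (e := by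
          rw [← RelCtx.mapFunctor_id, ← RelCtx.mapFunctor_id])]
        simp [← Functor.map_comp] }

noncomputable def compHom (f : Hom C D) (g : Hom D E) : Hom C E where
  fn := g.fn ∘ f.fn
  nat :=
    { app X := f.nat.app X ≫ g.nat.app _ ≫
        E.P.map (eqToHom (RelCtx.mapFunctor_comp f.fn g.fn X))
      naturality X Y A := by
        have h := g.nat.naturality ((RelCtx.mapFunctor f.fn).map A)
        have h' := f.nat.naturality A
        simp only [Functor.comp_map, Functor.comp_obj] at h h' ⊢
        rw [reassoc_of% h', reassoc_of% h]
        simp only [Category.assoc]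
        rw [← Functor.map_comp, ← Functor.map_comp, RelCtx.mapFunctor_comp_map] }
  isMonoidal :=
    { unit := by
        have hf := NatTrans.IsMonoidal.unit (τ := f.nat)
        have hg := NatTrans.IsMonoidal.unit (τ := g.nat)
        rw [Functor.LaxMonoidal.comp_ε, RelCtx.mapFunctor_ε] at *
        rw [reassoc_of% hf]
        have h := g.nat.naturality (eqToHom (RelCtx.mapFunctor_unit f.fn))
        simp only [Functor.comp_map, Functor.comp_obj] at h ⊢
        rw [reassoc_of% h, reassoc_of% hg]
        simp [eqToHom_map]
      tensor X Y := by
        have hf := NatTrans.IsMonoidal.tensor (τ := f.nat) X Y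
        have hg := NatTrans.IsMonoidal.tensor (τ := g.nat) ((RelCtx.mapFunctor f.fn).obj X)
          ((RelCtx.mapFunctor f.fn).obj Y)
        rw [Functor.LaxMonoidal.comp_μ, RelCtx.mapFunctor_μ] at *
        dsimp only
        have h := g.nat.naturality (eqToHom (RelCtx.mapFunctor_tensor f.fn X Y))
        simp only [Functor.comp_map, Functor.comp_obj] at h hf hg ⊢
        rw [reassoc_of% hf, reassoc_of% h, reassoc_of% hg]
        simp only [← tensorHom_comp_tensorHom, Category.assoc]
        have k := map_eqToHom_μ E (RelCtx.mapFunctor_comp f.fn g.fn X)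
          (RelCtx.mapFunctor_comp f.fn g.fn Y) (by
            rw [RelCtx.mapFunctor_comp, RelCtx.mapFunctor_comp])
        rw [reassoc_of% k]
        simp only [eqToHom_map, eqToHom_trans] }

noncomputable instance : Category RgCalc.{u, v} where
  Hom := Hom
  id := idHom
  comp := compHom
  id_comp f := by
    refine Hom.ext_heq rfl fun X => heq_of_eq ?_
    have h := f.nat.naturality (eqToHom (RelCtx.mapFunctor_id X))
    simp only [Functor.comp_map, Functor.comp_obj] at h
    simp only [compHom, idHom, Functor.comp_obj]
    rw [reassoc_of% h]
    simp only [eqToHom_map, eqToHom_trans, eqToHom_refl]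
    exact Category.comp_id _
  comp_id f := by
    refine Hom.ext_heq rfl fun X => heq_of_eq ?_
    simp only [compHom, idHom, Functor.comp_obj, ← Functor.map_comp, eqToHom_trans]
    exact (congrArg (f.nat.app X ≫ ·) (CategoryTheory.Functor.map_id _ _)).trans (Category.comp_id _)
  assoc f g h := by
    refine Hom.ext_heq rfl fun X => heq_of_eq ?_
    have n := h.nat.naturality (eqToHom (RelCtx.mapFunctor_comp f.fn g.fn X))
    simp only [Functor.comp_map, Functor.comp_obj] at n
    simp only [compHom, Functor.comp_obj, Category.assoc]
    rw [reassoc_of% n]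
    simp only [eqToHom_map, eqToHom_trans]

end RgCalc

/-! ## Internal relations of a regular calculus -/

namespace Ctx

variable {T : Type u} {Γ Δ Θ Λ : Ctx T}

/-- The diagonal `δ_Γ : Γ ⟶ Γ ⊕ Γ`. -/
noncomputable def diag (Γ : Ctx T) : Γ ⟶ sum Γ Γ := lift (𝟙 Γ) (𝟙 Γ)

/-- The composition wiring `(Γ ⊕ Δ) ⊕ (Δ ⊕ Θ) ⟶ Γ ⊕ Θ`, which joins the two copies of `Δ`: the
cograph of `⟨1, 2, 2, 3⟩ : Γ ⊕ Δ ⊕ Θ ⟶ (Γ ⊕ Δ) ⊕ (Δ ⊕ Θ)` followed by the graph of the projection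
`Γ ⊕ Δ ⊕ Θ ⟶ Γ ⊕ Θ`. -/
noncomputable def compRel (Γ Δ Θ : Ctx T) : Rel (sum (sum Γ Δ) (sum Δ Θ)) (sum Γ Θ) :=
  relComp
    (cograph (lift (lift (fst Γ (sum Δ Θ)) (snd Γ (sum Δ Θ) ≫ fst Δ Θ)) (snd Γ (sum Δ Θ))))
    (graph (lift (fst Γ (sum Δ Θ)) (snd Γ (sum Δ Θ) ≫ snd Δ Θ)))

@[simp]
theorem compRel_supp (t : T) : t ∈ (compRel Γ Δ Θ).supp ↔
    t ∈ Γ.supp ∨ t ∈ Δ.supp ∨ t ∈ Θ.supp := by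
  simp only [compRel, mem_relComp_supp, graph_supp, cograph_supp, mem_supp_sum]
  tauto

theorem holds_compRel (a : Fin Γ.arity → Prop) (b b' : Fin Δ.arity → Prop)
    (c : Fin Θ.arity → Prop) (a' : Fin Γ.arity → Prop) (c' : Fin Θ.arity → Prop) :
    (compRel Γ Δ Θ).Holds (copair (copair (copair a b) (copair b' c)) (copair a' c')) ↔
      a' = a ∧ b = b' ∧ c' = c := by
  simp only [compRel, holds_relComp, holds_graph, exists_copair, holds_cograph,
    copair_inj, comp_lift_fn, comp_comp_fn, copair_comp_fst, copair_comp_snd]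
  grind

theorem point_zero_iff {α : Sort*} (a b : Fin (zero T).arity → α) : a = b ↔ True :=
  iff_true_intro (point_zero_eq a b)

set_option linter.unusedSimpArgs false

theorem diag_comp_codiag : relComp (graph (diag Γ)) (cograph (diag Γ)) = graph (𝟙 Γ) := by
  refine SubObj.ext_holds (Finset.ext fun t => ?_) ?_
  · simp only [compRel_supp, mem_relComp_supp, mem_relTensor_supp, graph_supp, cograph_supp,
      mem_supp_sum, not_mem_zero_supp]
    tauto
  · simp only [forall_copair, exists_copair, holds_relComp, holds_relTensor, holds_compRel,
      holds_graph, holds_cograph, copair_inj, diag, assocIso, leftIso, rightIso, comp_lift_fn,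
      comp_comp_fn, id_fn, Function.comp_id, copair_comp_fst, copair_comp_snd, point_zero_iff]
    grind

theorem graph_fst_eq : graph (fst Γ Δ) =
    relComp (relTensor (graph (𝟙 Γ)) (graph (toZero Δ))) (graph (rightIso Γ).hom) := by
  refine SubObj.ext_holds (Finset.ext fun t => ?_) ?_
  · simp only [compRel_supp, mem_relComp_supp, mem_relTensor_supp, graph_supp, cograph_supp,
      mem_supp_sum, not_mem_zero_supp]
    tauto
  · simp only [forall_copair, exists_copair, holds_relComp, holds_relTensor, holds_compRel,
      holds_graph, holds_cograph, copair_inj, diag, assocIso, leftIso, rightIso, comp_lift_fn,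
      comp_comp_fn, id_fn, Function.comp_id, copair_comp_fst, copair_comp_snd, point_zero_iff]
    grind

theorem graph_snd_eq : graph (snd Γ Δ) =
    relComp (relTensor (graph (toZero Γ)) (graph (𝟙 Δ))) (graph (leftIso Δ).hom) := by
  refine SubObj.ext_holds (Finset.ext fun t => ?_) ?_
  · simp only [compRel_supp, mem_relComp_supp, mem_relTensor_supp, graph_supp, cograph_supp,
      mem_supp_sum, not_mem_zero_supp]
    tauto
  · simp only [forall_copair, exists_copair, holds_relComp, holds_relTensor, holds_compRel,
      holds_graph, holds_cograph, copair_inj, diag, assocIso, leftIso, rightIso, comp_lift_fn,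
      comp_comp_fn, id_fn, Function.comp_id, copair_comp_fst, copair_comp_snd, point_zero_iff]
    grind

theorem diag_le_fst : graph (diag Γ) ≤ relComp (graph (rightIso Γ).inv) 
    (relTensor (graph (𝟙 Γ)) (cograph (toZero Γ))) := by
  refine SubObj.le_of_holds (fun t => ?_) ?_
  · simp only [compRel_supp, mem_relComp_supp, mem_relTensor_supp, graph_supp, cograph_supp,
      mem_supp_sum, not_mem_zero_supp]
    tauto
  · simp only [forall_copair, exists_copair, holds_relComp, holds_relTensor, holds_compRel,
      holds_graph, holds_cograph, copair_inj, diag, assocIso, leftIso, rightIso, comp_lift_fn,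
      comp_comp_fn, id_fn, Function.comp_id, copair_comp_fst, copair_comp_snd, point_zero_iff]
    grind

theorem diag_le_snd : graph (diag Γ) ≤ relComp (graph (leftIso Γ).inv) 
    (relTensor (cograph (toZero Γ)) (graph (𝟙 Γ))) := by
  refine SubObj.le_of_holds (fun t => ?_) ?_
  · simp only [compRel_supp, mem_relComp_supp, mem_relTensor_supp, graph_supp, cograph_supp,
      mem_supp_sum, not_mem_zero_supp]
    tauto
  · simp only [forall_copair, exists_copair, holds_relComp, holds_relTensor, holds_compRel,
      holds_graph, holds_cograph, copair_inj, diag, assocIso, leftIso, rightIso, comp_lift_fn,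
      comp_comp_fn, id_fn, Function.comp_id, copair_comp_fst, copair_comp_snd, point_zero_iff]
    simp

theorem compRel_fst : relComp (compRel Γ Δ Θ) (graph (fst Γ Θ)) ≤
    relComp (graph (fst (sum Γ Δ) (sum Δ Θ))) (graph (fst Γ Δ)) := by
  refine SubObj.le_of_holds (fun t => ?_) ?_
  · simp only [compRel_supp, mem_relComp_supp, mem_relTensor_supp, graph_supp, cograph_supp,
      mem_supp_sum, not_mem_zero_supp]
    tauto
  · simp only [forall_copair, exists_copair, holds_relComp, holds_relTensor, holds_compRel,
      holds_graph, holds_cograph, copair_inj, diag, assocIso, leftIso, rightIso, comp_lift_fn,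
      comp_comp_fn, id_fn, Function.comp_id, copair_comp_fst, copair_comp_snd, point_zero_iff]
    grind

theorem compRel_snd : relComp (compRel Γ Δ Θ) (graph (snd Γ Θ)) ≤
    relComp (graph (snd (sum Γ Δ) (sum Δ Θ))) (graph (snd Δ Θ)) := by
  refine SubObj.le_of_holds (fun t => ?_) ?_
  · simp only [compRel_supp, mem_relComp_supp, mem_relTensor_supp, graph_supp, cograph_supp,
      mem_supp_sum, not_mem_zero_supp]
    tauto
  · simp only [forall_copair, exists_copair, holds_relComp, holds_relTensor, holds_compRel,
      holds_graph, holds_cograph, copair_inj, diag, assocIso, leftIso, rightIso, comp_lift_fn,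
      comp_comp_fn, id_fn, Function.comp_id, copair_comp_fst, copair_comp_snd, point_zero_iff]
    grind

theorem compRel_assoc :
    relComp (relTensor (compRel Γ Δ Θ) (graph (𝟙 (sum Θ Λ)))) (compRel Γ Θ Λ) =
    relComp (graph (assocIso (sum Γ Δ) (sum Δ Θ) (sum Θ Λ)).hom)
      (relComp (relTensor (graph (𝟙 (sum Γ Δ))) (compRel Δ Θ Λ)) (compRel Γ Δ Λ)) := by
  refine SubObj.ext_holds (Finset.ext fun t => ?_) ?_
  · simp only [compRel_supp, mem_relComp_supp, mem_relTensor_supp, graph_supp, cograph_supp,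
      mem_supp_sum, not_mem_zero_supp]
    tauto
  · simp only [forall_copair, exists_copair, holds_relComp, holds_relTensor, holds_compRel,
      holds_graph, holds_cograph, copair_inj, diag, assocIso, leftIso, rightIso, comp_lift_fn,
      comp_comp_fn, id_fn, Function.comp_id, copair_comp_fst, copair_comp_snd, point_zero_iff]
    grind

theorem compRel_diag_le :
    relComp (relTensor (graph (𝟙 (sum Γ Δ))) (graph (diag Δ))) (compRel Γ Δ Δ) ≤
      graph (fst (sum Γ Δ) Δ) := by
  refine SubObj.le_of_holds (fun t => ?_) ?_
  · simp only [compRel_supp, mem_relComp_supp, mem_relTensor_supp, graph_supp, cograph_supp,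
      mem_supp_sum, not_mem_zero_supp]
    tauto
  · simp only [forall_copair, exists_copair, holds_relComp, holds_relTensor, holds_compRel,
      holds_graph, holds_cograph, copair_inj, diag, assocIso, leftIso, rightIso, comp_lift_fn,
      comp_comp_fn, id_fn, Function.comp_id, copair_comp_fst, copair_comp_snd, point_zero_iff]
    grind

theorem diag_compRel_le :
    relComp (relTensor (graph (diag Γ)) (graph (𝟙 (sum Γ Δ)))) (compRel Γ Γ Δ) ≤
      graph (snd Γ (sum Γ Δ)) := by
  refine SubObj.le_of_holds (fun t => ?_) ?_
  · simp only [compRel_supp, mem_relComp_supp, mem_relTensor_supp, graph_supp, cograph_supp,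
      mem_supp_sum, not_mem_zero_supp]
    tauto
  · simp only [forall_copair, exists_copair, holds_relComp, holds_relTensor, holds_compRel,
      holds_graph, holds_cograph, copair_inj, diag, assocIso, leftIso, rightIso, comp_lift_fn,
      comp_comp_fn, id_fn, Function.comp_id, copair_comp_fst, copair_comp_snd, point_zero_iff]
    grind

theorem le_compRel_diag : cograph (diag (sum Γ Δ)) ≤
    relComp (relTensor (graph (𝟙 (sum Γ Δ))) (graph (snd Γ Δ)))
      (relComp (relTensor (graph (𝟙 (sum Γ Δ))) (graph (diag Δ))) (compRel Γ Δ Δ)) := by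
  refine SubObj.le_of_holds (fun t => ?_) ?_
  · simp only [compRel_supp, mem_relComp_supp, mem_relTensor_supp, graph_supp, cograph_supp,
      mem_supp_sum, not_mem_zero_supp]
    tauto
  · simp only [forall_copair, exists_copair, holds_relComp, holds_relTensor, holds_compRel,
      holds_graph, holds_cograph, copair_inj, diag, assocIso, leftIso, rightIso, comp_lift_fn,
      comp_comp_fn, id_fn, Function.comp_id, copair_comp_fst, copair_comp_snd, point_zero_iff]
    grind

theorem le_diag_compRel : cograph (diag (sum Γ Δ)) ≤
    relComp (relTensor (graph (fst Γ Δ)) (graph (𝟙 (sum Γ Δ))))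
      (relComp (relTensor (graph (diag Γ)) (graph (𝟙 (sum Γ Δ)))) (compRel Γ Γ Δ)) := by
  refine SubObj.le_of_holds (fun t => ?_) ?_
  · simp only [compRel_supp, mem_relComp_supp, mem_relTensor_supp, graph_supp, cograph_supp,
      mem_supp_sum, not_mem_zero_supp]
    tauto
  · simp only [forall_copair, exists_copair, holds_relComp, holds_relTensor, holds_compRel,
      holds_graph, holds_cograph, copair_inj, diag, assocIso, leftIso, rightIso, comp_lift_fn,
      comp_comp_fn, id_fn, Function.comp_id, copair_comp_fst, copair_comp_snd, point_zero_iff]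
    grind

theorem id_le_toZero : graph (𝟙 Γ) ≤ relComp (graph (toZero Γ)) (cograph (toZero Γ)) := by
  refine SubObj.le_of_holds (fun t => ?_) ?_
  · simp only [compRel_supp, mem_relComp_supp, mem_relTensor_supp, graph_supp, cograph_supp,
      mem_supp_sum, not_mem_zero_supp]
    tauto
  · simp only [forall_copair, exists_copair, holds_relComp, holds_relTensor, holds_compRel,
      holds_graph, holds_cograph, copair_inj, diag, assocIso, leftIso, rightIso, comp_lift_fn,
      comp_comp_fn, id_fn, Function.comp_id, copair_comp_fst, copair_comp_snd, point_zero_iff]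
    simp

end Ctx

namespace RgCalc

open Functor.LaxMonoidal

variable (C : RgCalc.{u, v}) {X Y Z W : RelCtx C.T}

/-- The action of relations on predicates: `P(A) : P(Γ) ⟶ P(Δ)`. -/
def act (A : X ⟶ Y) (x : C.P.obj X) : C.P.obj Y := (C.P.map A).hom x

/-- The direct image `f_! : P(Γ) ⟶ P(Δ)` along a morphism `f : Γ ⟶ Δ` of `FRg(T)`. -/
noncomputable def push {Γ Δ : Ctx C.T} (f : Γ ⟶ Δ) : C.P.obj ⟨Γ⟩ → C.P.obj ⟨Δ⟩ :=
  C.act (X := ⟨Γ⟩) (Y := ⟨Δ⟩) (Ctx.graph f)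

/-- Juxtaposition of predicates: the laxator `ρ : P(Γ) × P(Δ) ⟶ P(Γ ⊕ Δ)`. -/
noncomputable def juxt (x : C.P.obj X) (y : C.P.obj Y) : C.P.obj (X ⊗ Y) := (μ C.P X Y).hom (x, y)

/-- The laxator `ρ : 1 ⟶ P(0)`. -/
noncomputable def star : C.P.obj (𝟙_ (RelCtx C.T)) := (ε C.P).hom PUnit.unit

theorem act_id (x : C.P.obj X) : C.act (𝟙 X) x = x := by
  simp [act]

theorem act_comp (A : X ⟶ Y) (B : Y ⟶ Z) (x : C.P.obj X) :
    C.act (A ≫ B) x = C.act B (C.act A x) := by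
  simp [act]

theorem act_mono {A B : X ⟶ Y} (h : A ≤ B) {x y : C.P.obj X} (h' : x ≤ y) :
    C.act A x ≤ C.act B y :=
  ((C.P.map A).hom.monotone h').trans (IsAjax.map_mono (F := C.P) h y)

theorem juxt_mono {x x' : C.P.obj X} {y y' : C.P.obj Y} (h : x ≤ x') (h' : y ≤ y') :
    C.juxt x y ≤ C.juxt x' y' :=
  (μ C.P X Y).hom.monotone (show ((x, y) : C.P.obj X × C.P.obj Y) ≤ (x', y') from ⟨h, h'⟩)

theorem act_juxt (A : X ⟶ Z) (B : Y ⟶ W) (x : C.P.obj X) (y : C.P.obj Y) :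
    C.act (A ⊗ₘ B) (C.juxt x y) = C.juxt (C.act A x) (C.act B y) :=
  (congrArg (fun f => f.hom (x, y)) (Functor.LaxMonoidal.μ_natural C.P A B)).symm

theorem juxt_assoc (x : C.P.obj X) (y : C.P.obj Y) (z : C.P.obj Z) :
    C.act (α_ X Y Z).hom (C.juxt (C.juxt x y) z) = C.juxt x (C.juxt y z) :=
  congrArg (fun f => f.hom ((x, y), z)) (Functor.LaxMonoidal.associativity C.P X Y Z)

theorem juxt_star (x : C.P.obj X) : C.act (ρ_ X).hom (C.juxt x C.star) = x :=
  (congrArg (fun f => f.hom (x, PUnit.unit)) (Functor.LaxMonoidal.right_unitality C.P X)).symm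

theorem star_juxt (x : C.P.obj X) : C.act (λ_ X).hom (C.juxt C.star x) = x :=
  (congrArg (fun f => f.hom (PUnit.unit, x)) (Functor.LaxMonoidal.left_unitality C.P X)).symm

theorem le_star (x : C.P.obj (𝟙_ (RelCtx C.T))) : x ≤ C.star := by
  obtain ⟨L, h, -⟩ := IsAjax.unit_isRightAdj (F := C.P)
  exact h x

theorem le_juxt {z : C.P.obj (X ⊗ Y)} {x : C.P.obj X} {y : C.P.obj Y} {x' : C.P.obj X}
    {y' : C.P.obj Y} (h : z ≤ C.juxt x y') (h' : z ≤ C.juxt x' y) : z ≤ C.juxt x y := by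
  obtain ⟨L, hL, hR⟩ := IsAjax.tensor_isRightAdj (F := C.P) X Y
  have e (a : C.P.obj X) (b : C.P.obj Y) (hz : z ≤ C.juxt a b) :
      (L.hom z : C.P.obj X × C.P.obj Y) ≤ (a, b) :=
    (L.hom.monotone hz).trans (hR (a, b))
  exact (hL z).trans ((μ C.P X Y).hom.monotone
    (show (L.hom z : C.P.obj X × C.P.obj Y) ≤ (x, y) from ⟨(e _ _ h).1, (e _ _ h').2⟩))

theorem push_fst_juxt {Γ Δ : Ctx C.T} (x : C.P.obj ⟨Γ⟩) (y : C.P.obj ⟨Δ⟩) :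
    C.push (Ctx.fst Γ Δ) (C.juxt x y) ≤ x := by
  rw [push, Ctx.graph_fst_eq]
  change C.act ((𝟙 (RelCtx.mk Γ) ⊗ₘ (show RelCtx.mk Δ ⟶ 𝟙_ _ from Ctx.graph (Ctx.toZero Δ))) ≫
    (ρ_ (RelCtx.mk Γ)).hom) (C.juxt x y) ≤ x
  rw [act_comp, act_juxt, act_id]
  conv_rhs => rw [← C.juxt_star x]
  exact C.act_mono le_rfl (C.juxt_mono le_rfl (C.le_star _))

theorem push_snd_juxt {Γ Δ : Ctx C.T} (x : C.P.obj ⟨Γ⟩) (y : C.P.obj ⟨Δ⟩) :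
    C.push (Ctx.snd Γ Δ) (C.juxt x y) ≤ y := by
  rw [push, Ctx.graph_snd_eq]
  change C.act (((show RelCtx.mk Γ ⟶ 𝟙_ _ from Ctx.graph (Ctx.toZero Γ)) ⊗ₘ 𝟙 (RelCtx.mk Δ)) ≫
    (λ_ (RelCtx.mk Δ)).hom) (C.juxt x y) ≤ y
  rw [act_comp, act_juxt, act_id]
  conv_rhs => rw [← C.star_juxt y]
  exact C.act_mono le_rfl (C.juxt_mono (C.le_star _) le_rfl)

theorem push_diag_le_left {Γ : Ctx C.T} {z x : C.P.obj ⟨Γ⟩} (h : z ≤ x) :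
    ∃ y, C.push (Ctx.diag Γ) z ≤ C.juxt x y := by
  let B : 𝟙_ (RelCtx C.T) ⟶ RelCtx.mk Γ := Ctx.cograph (Ctx.toZero Γ)
  refine ⟨C.act B C.star, ?_⟩
  have : C.juxt x (C.act B C.star) = C.act ((ρ_ (RelCtx.mk Γ)).inv ≫ (𝟙 _ ⊗ₘ B)) x := by
    rw [act_comp]
    conv_rhs => rw [← C.juxt_star x]
    rw [← act_comp C (ρ_ _).hom, Iso.hom_inv_id, act_id, act_juxt, act_id]
  rw [this]
  exact C.act_mono (Ctx.diag_le_fst (Γ := Γ)) h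

theorem push_diag_le_right {Γ : Ctx C.T} {z y : C.P.obj ⟨Γ⟩} (h : z ≤ y) :
    ∃ x, C.push (Ctx.diag Γ) z ≤ C.juxt x y := by
  let B : 𝟙_ (RelCtx C.T) ⟶ RelCtx.mk Γ := Ctx.cograph (Ctx.toZero Γ)
  refine ⟨C.act B C.star, ?_⟩
  have : C.juxt (C.act B C.star) y = C.act ((λ_ (RelCtx.mk Γ)).inv ≫ (B ⊗ₘ 𝟙 _)) y := by
    rw [act_comp]
    conv_rhs => rw [← C.star_juxt y]
    rw [← act_comp C (λ_ _).hom, Iso.hom_inv_id, act_id, act_juxt, act_id]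
  rw [this]
  exact C.act_mono (Ctx.diag_le_snd (Γ := Γ)) h

/-- The predicates in a context have meets, given by juxtaposition and the diagonal. -/
theorem le_meet {Γ : Ctx C.T} {z x y : C.P.obj ⟨Γ⟩} (h : z ≤ x) (h' : z ≤ y) :
    z ≤ C.act (X := ⟨Ctx.sum Γ Γ⟩) (Y := ⟨Γ⟩) (Ctx.cograph (Ctx.diag Γ)) (C.juxt x y) := by
  obtain ⟨y', hy⟩ := C.push_diag_le_left h
  obtain ⟨x', hx⟩ := C.push_diag_le_right h'
  have e : (show RelCtx.mk Γ ⟶ RelCtx.mk (Ctx.sum Γ Γ) from Ctx.graph (Ctx.diag Γ)) ≫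
      (show RelCtx.mk (Ctx.sum Γ Γ) ⟶ RelCtx.mk Γ from Ctx.cograph (Ctx.diag Γ)) =
      𝟙 (RelCtx.mk Γ) := Ctx.diag_comp_codiag
  conv_lhs => rw [← C.act_id z, ← e, act_comp]
  exact C.act_mono le_rfl (C.le_juxt hy hx)

/-! ### Internal relations -/

/-- `θ ∈ P(Γ ⊕ Δ)` is an internal relation from `φ ∈ P(Γ)` to `ψ ∈ P(Δ)` if its projections are
contained in `φ` and `ψ`. -/
def IsIntRel {Γ Δ : Ctx C.T} (φ : C.P.obj ⟨Γ⟩) (ψ : C.P.obj ⟨Δ⟩)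
    (θ : C.P.obj ⟨Ctx.sum Γ Δ⟩) : Prop :=
  C.push (Ctx.fst Γ Δ) θ ≤ φ ∧ C.push (Ctx.snd Γ Δ) θ ≤ ψ

/-- The identity internal relation `(δ_Γ)_! φ`. -/
noncomputable def idTerm {Γ : Ctx C.T} (φ : C.P.obj ⟨Γ⟩) : C.P.obj ⟨Ctx.sum Γ Γ⟩ :=
  C.push (Ctx.diag Γ) φ

/-- The composite of internal relations:
`P(Γ ⊕ Δ) × P(Δ ⊕ Θ) ⟶ P((Γ ⊕ Δ) ⊕ (Δ ⊕ Θ)) ⟶ P(Γ ⊕ Θ)`. -/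
noncomputable def compTerm {Γ Δ Θ : Ctx C.T} (θ : C.P.obj ⟨Ctx.sum Γ Δ⟩)
    (θ' : C.P.obj ⟨Ctx.sum Δ Θ⟩) : C.P.obj ⟨Ctx.sum Γ Θ⟩ :=
  C.act (X := ⟨Ctx.sum (Ctx.sum Γ Δ) (Ctx.sum Δ Θ)⟩) (Y := ⟨Ctx.sum Γ Θ⟩)
    (Ctx.compRel Γ Δ Θ) (C.juxt θ θ')

variable {C} {Γ Δ Θ Λ : Ctx C.T}

theorem isIntRel_idTerm (φ : C.P.obj ⟨Γ⟩) : C.IsIntRel φ φ (C.idTerm φ) := by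
  have e : ∀ f : Ctx.sum Γ Γ ⟶ Γ, Ctx.diag Γ ≫ f = 𝟙 Γ → C.push f (C.idTerm φ) = φ := by
    intro f hf
    have := C.act_comp (X := ⟨Γ⟩) (Y := ⟨Ctx.sum Γ Γ⟩) (Z := ⟨Γ⟩) (Ctx.graph (Ctx.diag Γ))
      (Ctx.graph f) φ
    refine this.symm.trans (Eq.trans ?_ (C.act_id φ))
    exact congrArg (fun A => C.act (X := ⟨Γ⟩) (Y := ⟨Γ⟩) A φ)
      ((Ctx.graph_comp _ _).symm.trans (congrArg Ctx.graph hf))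
  exact ⟨(e _ (Ctx.lift_fst _ _)).le, (e _ (Ctx.lift_snd _ _)).le⟩

theorem push_le_of_le {φ : C.P.obj ⟨Γ⟩} {f : Δ ⟶ Γ} {g : Θ ⟶ Δ} {x : C.P.obj ⟨Θ⟩}
    {A : Ctx.Rel Θ Λ} {h : Λ ⟶ Γ}
    (e : Ctx.relComp A (Ctx.graph h) ≤ Ctx.relComp (Ctx.graph g) (Ctx.graph f))
    (hx : C.push f (C.push g x) ≤ φ) :
    C.push h (C.act (X := ⟨Θ⟩) (Y := ⟨Λ⟩) A x) ≤ φ := by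
  have h₁ := C.act_comp (X := ⟨Θ⟩) (Y := ⟨Λ⟩) (Z := ⟨Γ⟩) A (Ctx.graph h) x
  have h₂ := C.act_comp (X := ⟨Θ⟩) (Y := ⟨Δ⟩) (Z := ⟨Γ⟩) (Ctx.graph g) (Ctx.graph f) x
  exact h₁.symm.le.trans ((C.act_mono (X := ⟨Θ⟩) (Y := ⟨Γ⟩) e le_rfl).trans (h₂.le.trans hx))

theorem IsIntRel.comp {φ : C.P.obj ⟨Γ⟩} {ψ : C.P.obj ⟨Δ⟩} {χ : C.P.obj ⟨Θ⟩}
    {θ : C.P.obj ⟨Ctx.sum Γ Δ⟩} {θ' : C.P.obj ⟨Ctx.sum Δ Θ⟩} (h : C.IsIntRel φ ψ θ)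
    (h' : C.IsIntRel ψ χ θ') : C.IsIntRel φ χ (C.compTerm θ θ') :=
  ⟨push_le_of_le Ctx.compRel_fst
      ((C.act_mono le_rfl (C.push_fst_juxt θ θ')).trans h.1),
    push_le_of_le Ctx.compRel_snd
      ((C.act_mono le_rfl (C.push_snd_juxt θ θ')).trans h'.2)⟩

theorem compTerm_mono {θ η : C.P.obj ⟨Ctx.sum Γ Δ⟩} {θ' η' : C.P.obj ⟨Ctx.sum Δ Θ⟩}
    (h : θ ≤ η) (h' : θ' ≤ η') : C.compTerm θ θ' ≤ C.compTerm η η' :=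
  C.act_mono le_rfl (C.juxt_mono h h')

theorem compTerm_assoc (θ : C.P.obj ⟨Ctx.sum Γ Δ⟩) (θ' : C.P.obj ⟨Ctx.sum Δ Θ⟩)
    (θ'' : C.P.obj ⟨Ctx.sum Θ Λ⟩) :
    C.compTerm (C.compTerm θ θ') θ'' = C.compTerm θ (C.compTerm θ' θ'') := by
  let W₁ : RelCtx.mk (Ctx.sum (Ctx.sum Γ Δ) (Ctx.sum Δ Θ)) ⟶ RelCtx.mk (Ctx.sum Γ Θ) :=
    Ctx.compRel Γ Δ Θ
  let W₂ : RelCtx.mk (Ctx.sum (Ctx.sum Γ Θ) (Ctx.sum Θ Λ)) ⟶ RelCtx.mk (Ctx.sum Γ Λ) :=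
    Ctx.compRel Γ Θ Λ
  let W₃ : RelCtx.mk (Ctx.sum (Ctx.sum Δ Θ) (Ctx.sum Θ Λ)) ⟶ RelCtx.mk (Ctx.sum Δ Λ) :=
    Ctx.compRel Δ Θ Λ
  let W₄ : RelCtx.mk (Ctx.sum (Ctx.sum Γ Δ) (Ctx.sum Δ Λ)) ⟶ RelCtx.mk (Ctx.sum Γ Λ) :=
    Ctx.compRel Γ Δ Λ
  have e₁ : C.compTerm (C.compTerm θ θ') θ'' =
      C.act ((W₁ ⊗ₘ 𝟙 (RelCtx.mk (Ctx.sum Θ Λ))) ≫ W₂) (C.juxt (C.juxt θ θ') θ'') := by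
    rw [act_comp]
    refine congrArg (C.act W₂) ?_
    exact (congrArg (C.juxt (C.act W₁ _)) (C.act_id θ'').symm).trans
      (C.act_juxt W₁ (𝟙 (RelCtx.mk (Ctx.sum Θ Λ))) (C.juxt θ θ') θ'').symm
  have e₂ : C.compTerm θ (C.compTerm θ' θ'') =
      C.act ((𝟙 (RelCtx.mk (Ctx.sum Γ Δ)) ⊗ₘ W₃) ≫ W₄) (C.juxt θ (C.juxt θ' θ'')) := by
    rw [act_comp]
    refine congrArg (C.act W₄) ?_
    exact (congrArg (fun x => C.juxt x (C.act W₃ _)) (C.act_id θ).symm).trans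
      (C.act_juxt (𝟙 (RelCtx.mk (Ctx.sum Γ Δ))) W₃ θ (C.juxt θ' θ'')).symm
  refine e₁.trans (Eq.trans ?_ e₂.symm)
  have h := C.juxt_assoc (X := ⟨Ctx.sum Γ Δ⟩) (Y := ⟨Ctx.sum Δ Θ⟩) (Z := ⟨Ctx.sum Θ Λ⟩) θ θ' θ''
  refine Eq.trans ?_ (congrArg (C.act ((𝟙 (RelCtx.mk (Ctx.sum Γ Δ)) ⊗ₘ W₃) ≫ W₄)) h)
  refine Eq.trans ?_ (C.act_comp _ _ _)
  exact congrArg (fun A => C.act A (C.juxt (C.juxt θ θ') θ'')) Ctx.compRel_assoc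

theorem compTerm_idTerm {φ : C.P.obj ⟨Γ⟩} {ψ : C.P.obj ⟨Δ⟩} {θ : C.P.obj ⟨Ctx.sum Γ Δ⟩}
    (h : C.IsIntRel φ ψ θ) : C.compTerm θ (C.idTerm ψ) = θ := by
  let W : RelCtx.mk (Ctx.sum (Ctx.sum Γ Δ) (Ctx.sum Δ Δ)) ⟶ RelCtx.mk (Ctx.sum Γ Δ) :=
    Ctx.compRel Γ Δ Δ
  let d : RelCtx.mk Δ ⟶ RelCtx.mk (Ctx.sum Δ Δ) := Ctx.graph (Ctx.diag Δ)
  let s : RelCtx.mk (Ctx.sum Γ Δ) ⟶ RelCtx.mk Δ := Ctx.graph (Ctx.snd Γ Δ)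
  have e : C.compTerm θ (C.idTerm ψ) =
      C.act ((𝟙 (RelCtx.mk (Ctx.sum Γ Δ)) ⊗ₘ d) ≫ W) (C.juxt θ ψ) := by
    rw [act_comp, act_juxt, act_id]
    rfl
  refine le_antisymm ?_ ?_
  · rw [e]
    exact (C.act_mono Ctx.compRel_diag_le le_rfl).trans (C.push_fst_juxt θ ψ)
  · refine (C.le_meet (le_refl θ) (le_refl θ)).trans ?_
    refine (C.act_mono Ctx.le_compRel_diag le_rfl).trans ?_
    change C.act ((𝟙 (RelCtx.mk (Ctx.sum Γ Δ)) ⊗ₘ s) ≫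
      (𝟙 (RelCtx.mk (Ctx.sum Γ Δ)) ⊗ₘ d) ≫ W) (C.juxt θ θ) ≤ _
    rw [act_comp, act_juxt, act_id, e]
    exact C.act_mono le_rfl (C.juxt_mono le_rfl h.2)

theorem idTerm_compTerm {φ : C.P.obj ⟨Γ⟩} {ψ : C.P.obj ⟨Δ⟩} {θ : C.P.obj ⟨Ctx.sum Γ Δ⟩}
    (h : C.IsIntRel φ ψ θ) : C.compTerm (C.idTerm φ) θ = θ := by
  let W : RelCtx.mk (Ctx.sum (Ctx.sum Γ Γ) (Ctx.sum Γ Δ)) ⟶ RelCtx.mk (Ctx.sum Γ Δ) :=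
    Ctx.compRel Γ Γ Δ
  let d : RelCtx.mk Γ ⟶ RelCtx.mk (Ctx.sum Γ Γ) := Ctx.graph (Ctx.diag Γ)
  let s : RelCtx.mk (Ctx.sum Γ Δ) ⟶ RelCtx.mk Γ := Ctx.graph (Ctx.fst Γ Δ)
  have e : C.compTerm (C.idTerm φ) θ =
      C.act ((d ⊗ₘ 𝟙 (RelCtx.mk (Ctx.sum Γ Δ))) ≫ W) (C.juxt φ θ) := by
    rw [act_comp, act_juxt, act_id]
    rfl
  refine le_antisymm ?_ ?_
  · rw [e]
    exact (C.act_mono Ctx.diag_compRel_le le_rfl).trans (C.push_snd_juxt φ θ)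
  · refine (C.le_meet (le_refl θ) (le_refl θ)).trans ?_
    refine (C.act_mono Ctx.le_diag_compRel le_rfl).trans ?_
    change C.act ((s ⊗ₘ 𝟙 (RelCtx.mk (Ctx.sum Γ Δ))) ≫
      (d ⊗ₘ 𝟙 (RelCtx.mk (Ctx.sum Γ Δ))) ≫ W) (C.juxt θ θ) ≤ _
    rw [act_comp, act_juxt, act_id, e]
    exact C.act_mono le_rfl (C.juxt_mono h.1 le_rfl)

end RgCalc

/-- An object `(Γ, φ)` of the po-category of internal relations of a regular calculus: a context
and a predicate `φ ∈ P(Γ)`. -/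
structure IntRel (C : RgCalc.{u, v}) where
  ctx : Ctx C.T
  pred : C.P.obj ⟨ctx⟩

/-- The po-category of internal relations. -/
noncomputable instance (C : RgCalc.{u, v}) : Category.{v} (IntRel C) where
  Hom X Y := { θ : C.P.obj ⟨Ctx.sum X.ctx Y.ctx⟩ // C.IsIntRel X.pred Y.pred θ }
  id X := ⟨C.idTerm X.pred, RgCalc.isIntRel_idTerm X.pred⟩
  comp θ θ' := ⟨C.compTerm θ.1 θ'.1, θ.2.comp θ'.2⟩
  id_comp θ := Subtype.ext (RgCalc.idTerm_compTerm θ.2)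
  comp_id θ := Subtype.ext (RgCalc.compTerm_idTerm θ.2)
  assoc θ θ' θ'' := Subtype.ext (RgCalc.compTerm_assoc θ.1 θ'.1 θ''.1)

noncomputable instance (C : RgCalc.{u, v}) : PoCategory (IntRel C) where
  homOrder X Y := inferInstanceAs (PartialOrder
    { θ : C.P.obj ⟨Ctx.sum X.ctx Y.ctx⟩ // C.IsIntRel X.pred Y.pred θ })
  comp_le_comp h h' := RgCalc.compTerm_mono h h'

/-- The syntactic category `R_P` of a regular calculus: the left adjoints, called internal
functions, in the po-category of internal relations. -/
abbrev Syn (C : RgCalc.{u, v}) := LAdj (IntRel C)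

/-! ## Regular categories -/

/-- A (bundled) regular category. -/
structure RgCat where
  carrier : Type u
  [category : Category.{v} carrier]
  [regular : Regular carrier]

namespace RgCat

attribute [instance] category regular

/-- The bundled regular category given by a category that is regular. -/
abbrev of (A : Type u) [Category.{v} A] (h : Regular A) : RgCat.{u, v} := { carrier := A }

/-- A regular functor: a functor that preserves finite limits and regular epimorphisms. -/
@[ext]
structure Hom (A B : RgCat.{u, v}) where
  functor : A.carrier ⥤ B.carrier
  preservesFiniteLimits : Limits.PreservesFiniteLimits functor
  preservesRegularEpi {X Y : A.carrier} (f : X ⟶ Y) : IsRegularEpi f → IsRegularEpi (functor.map f)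

/-- The category of regular categories and regular functors. -/
instance : Category RgCat.{u, v} where
  Hom := Hom
  id A := ⟨𝟭 A.carrier, inferInstance, fun _ h => h⟩
  comp F G :=
    ⟨F.functor ⋙ G.functor,
      @Limits.comp_preservesFiniteLimits _ _ _ _ _ _ F.functor G.functor
        F.preservesFiniteLimits G.preservesFiniteLimits,
      fun f h => G.preservesRegularEpi _ (F.preservesRegularEpi f h)⟩

end RgCat

/-! ## The action of morphisms of regular calculi -/

namespace RgCalc

variable {C D : RgCalc.{u, v}} (f : C ⟶ D)

/-- The action on objects: `(Γ, φ) ↦ (F̄ Γ, F♯ φ)`. -/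
noncomputable def onObj (X : Syn C) : Syn D :=
  ⟨Ctx.map f.fn X.obj.ctx, (f.nat.app ⟨X.obj.ctx⟩).hom X.obj.pred⟩

/-- The action `F♯_{Γ ⊕ Δ}` on terms, with values in `P'(F̄ Γ ⊕ F̄ Δ) = P'(F̄ (Γ ⊕ Δ))`. -/
noncomputable def onTerm {Γ Δ : Ctx C.T} (θ : C.P.obj ⟨Ctx.sum Γ Δ⟩) :
    D.P.obj ⟨Ctx.sum (Ctx.map f.fn Γ) (Ctx.map f.fn Δ)⟩ :=
  D.act (eqToHom (RelCtx.mapFunctor_tensor f.fn ⟨Γ⟩ ⟨Δ⟩).symm)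
    ((f.nat.app ⟨Ctx.sum Γ Δ⟩).hom θ)

end RgCalc

namespace Syn

variable {C : RgCalc.{u, v}}

/-- `θ` is an internal function from `φ` to `ψ`, i.e. a morphism `φ ⟶ ψ` of `R_P`: it is an internal
relation and has a right adjoint internal relation. -/
def IsIntFun (X Y : Syn C) (θ : C.P.obj ⟨Ctx.sum X.obj.ctx Y.obj.ctx⟩) : Prop :=
  ∃ h : C.IsIntRel X.obj.pred Y.obj.pred θ,
    IsLeftAdj (show X.obj ⟶ Y.obj from Subtype.mk θ h)

/-- The morphism of `R_P` given by an internal function. -/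
def ofTerm {X Y : Syn C} {θ : C.P.obj ⟨Ctx.sum X.obj.ctx Y.obj.ctx⟩} (h : IsIntFun X Y θ) : X ⟶ Y :=
  ⟨⟨θ, h.fst⟩, h.snd⟩

/-- The term `θ ∈ P(Γ ⊕ Δ)` underlying a morphism of `R_P`. -/
def term {X Y : Syn C} (θ : X ⟶ Y) : C.P.obj ⟨Ctx.sum X.obj.ctx Y.obj.ctx⟩ := θ.1.1

end Syn

end GRL

open GRL

/-! A regular category is the category of maps of a unitary tabular allegory, and the internal
relations of a regular calculus form such an allegory. The converse of a term exchanges its two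
contexts, and the meet of two terms is their juxtaposition pulled back along the diagonal. A term
`θ` on `Γ ⊕ Δ` is tabulated by the object `(Γ ⊕ Δ, θ)` with its two projections, and the unit is the
empty context with the top predicate. In an allegory a right adjoint is the converse of its left
adjoint (`eq_dag_of_isAdj`), so the internal functions are exactly the maps.

The allegory laws are inequalities between conjunctive queries. Each side is a wiring applied to a
juxtaposition of terms, and `ap_le_ap` derives an inequality from a homomorphism of queries: a map
of contexts carrying the terms on the left to those on the right, such that the left wiring lies
below the composite of its graph with the right wiring. The homomorphisms are built with
`Forces.lift` out of projections; this is where right adjointness of the laxators enters. The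
inequality of wirings is a finite statement about supports and equalities of ports, checked on
valuations of the ports.

The rest is the calculus of maps. Pullbacks are tabulations of `f ≫ dag g`. Images come from
tabulating `dag f ≫ f`. A map is a regular epimorphism exactly when `dag f ≫ f` is the identity
(`LAdj.isRegularEpi_iff`). These descriptions use only composition, order, converse and meet, so any
functor that preserves this structure and a unit is regular on maps (`IsUnitaryFunctor`). A morphism
of regular calculi yields such a functor, since a change of types leaves every wiring diagram
unchanged and `F♯` is natural and monoidal. -/

namespace GRL

/-! ### Allegories and their maps -/

/-- An allegory: a po-category with an involution and binary meets of parallel morphisms that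
satisfy the modular law. -/
class Allegory (A : Type u) [Category.{v} A] [PoCategory A] where
  dag {X Y : A} : (X ⟶ Y) → (Y ⟶ X)
  dag_dag {X Y : A} (f : X ⟶ Y) : dag (dag f) = f
  dag_comp {X Y Z : A} (f : X ⟶ Y) (g : Y ⟶ Z) : dag (f ≫ g) = dag g ≫ dag f
  dag_mono {X Y : A} {f g : X ⟶ Y} : f ≤ g → dag f ≤ dag g
  meet {X Y : A} : (X ⟶ Y) → (X ⟶ Y) → (X ⟶ Y)
  meet_le_left {X Y : A} (f g : X ⟶ Y) : meet f g ≤ f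
  meet_le_right {X Y : A} (f g : X ⟶ Y) : meet f g ≤ g
  le_meet {X Y : A} {f g h : X ⟶ Y} : h ≤ f → h ≤ g → h ≤ meet f g
  modular {X Y Z : A} (f : X ⟶ Y) (g : Y ⟶ Z) (h : X ⟶ Z) :
    meet (f ≫ g) h ≤ meet f (h ≫ dag g) ≫ g

namespace Allegory

attribute [simp] dag_dag dag_comp

theorem comp_mono {A : Type u} [Category.{v} A] [PoCategory A]
    {X Y Z : A} {f f' : X ⟶ Y} {g g' : Y ⟶ Z}
    (hf : f ≤ f') (hg : g ≤ g') :
    f ≫ g ≤ f' ≫ g' := PoCategory.comp_le_comp hf hg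

/-- The unit of one adjunction is pasted with the counit of the other. Passing to adjoints reverses
the order, and the case `g = g'` gives uniqueness of left adjoints. -/
theorem le_of_isAdj {A : Type u} [Category.{v} A] [PoCategory A]
    {X Y : A} {f f' : X ⟶ Y} {g g' : Y ⟶ X} (h : IsAdj f g)
    (h' : IsAdj f' g')
    (hg : g' ≤ g) : f ≤ f' :=
  calc f = 𝟙 X ≫ f := (Category.id_comp f).symm
    _ ≤ (f' ≫ g') ≫ f := comp_mono h'.1 le_rfl
    _ ≤ (f' ≫ g) ≫ f := comp_mono (comp_mono le_rfl hg) le_rfl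
    _ = f' ≫ (g ≫ f) := Category.assoc _ _ _
    _ ≤ f' ≫ 𝟙 Y := comp_mono le_rfl h.2
    _ = f' := Category.comp_id f'

theorem ge_of_isAdj {A : Type u} [Category.{v} A] [PoCategory A]
    {X Y : A} {f f' : X ⟶ Y} {g g' : Y ⟶ X} (h : IsAdj f g)
    (h' : IsAdj f' g')
    (hf : f ≤ f') : g' ≤ g :=
  calc g' = 𝟙 Y ≫ g' := (Category.id_comp g').symm
    _ = g' ≫ 𝟙 X := by simp
    _ ≤ g' ≫ (f ≫ g) := comp_mono le_rfl h.1
    _ ≤ g' ≫ (f' ≫ g) := comp_mono le_rfl (comp_mono hf le_rfl)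
    _ = (g' ≫ f') ≫ g := (Category.assoc _ _ _).symm
    _ ≤ 𝟙 Y ≫ g := comp_mono h'.2 le_rfl
    _ = g := Category.id_comp g

variable {A : Type u} [Category.{v} A] [PoCategory A] [Allegory A] {W X Y Z : A}

theorem dag_le {f : X ⟶ Y} {g : Y ⟶ X} (h : f ≤ dag g) : dag f ≤ g := by
  simpa using dag_mono h

theorem dag_meet (f g : X ⟶ Y) : dag (meet f g) = meet (dag f) (dag g) :=
  le_antisymm (le_meet (dag_mono (meet_le_left _ _)) (dag_mono (meet_le_right _ _)))
    (by
      have h : dag (meet (dag f) (dag g)) ≤ meet f g :=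
        le_meet (dag_le (meet_le_left _ _)) (dag_le (meet_le_right _ _))
      simpa using dag_mono h)

@[simp]
theorem dag_id (X : A) : dag (𝟙 X) = 𝟙 X := by
  have : dag (dag (𝟙 X) ≫ 𝟙 X) = dag (𝟙 X) ≫ dag (dag (𝟙 X)) := dag_comp _ _
  simpa using this.symm

theorem modular' (f : X ⟶ Y) (g : Y ⟶ Z) (h : X ⟶ Z) :
    meet (f ≫ g) h ≤ f ≫ meet g (dag f ≫ h) := by
  have := dag_mono (modular (dag g) (dag f) (dag h))
  simpa [dag_meet] using this

/-- A map is a total and single-valued morphism. -/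
def IsMap (f : X ⟶ Y) : Prop := IsAdj f (dag f)

theorem IsMap.comp {f : X ⟶ Y} {g : Y ⟶ Z} (hf : IsMap f) (hg : IsMap g) : IsMap (f ≫ g) := by
  rw [IsMap, dag_comp]
  exact IsAdj.comp hf hg

/-- In an allegory a right adjoint is the converse of its left adjoint. -/
theorem eq_dag_of_isAdj {f : X ⟶ Y} {g : Y ⟶ X} (h : IsAdj f g) : g = dag f := by
  -- By the modular law the unit `𝟙 X ≤ f ≫ g` still holds when `g` is cut down to `meet g (dag f)`,
  -- and the counit only gets smaller. So both are right adjoints of `f` and must agree. Cutting `f`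
  -- down to `meet f (dag g)` works in the same way.
  have h₁ : 𝟙 X ≤ f ≫ meet g (dag f) :=
    (le_meet h.1 le_rfl).trans ((modular' f g (𝟙 X)).trans_eq (by simp))
  have h₂ : 𝟙 X ≤ meet f (dag g) ≫ g :=
    (le_meet h.1 le_rfl).trans ((modular f g (𝟙 X)).trans_eq (by simp))
  have h₃ : g ≤ meet g (dag f) :=
    ge_of_isAdj ⟨h₁, (comp_mono (meet_le_left _ _) le_rfl).trans h.2⟩ h le_rfl
  have h₄ : f ≤ meet f (dag g) :=
    le_of_isAdj h ⟨h₂, (comp_mono le_rfl (meet_le_left _ _)).trans h.2⟩ le_rfl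
  exact le_antisymm (h₃.trans (meet_le_right _ _)) (dag_le (h₄.trans (meet_le_right _ _)))

theorem isLeftAdj_iff_isMap {f : X ⟶ Y} : IsLeftAdj f ↔ IsMap f := by
  constructor
  · rintro ⟨g, h⟩
    rw [IsMap, ← eq_dag_of_isAdj h]
    exact h
  · exact fun h => ⟨_, h⟩

/-- Converse preserves the order whereas passage to adjoints reverses it, so the order between maps
is discrete. Equations of maps therefore need only one inequality. -/
theorem IsMap.eq_of_le {f g : X ⟶ Y} (hf : IsMap f) (hg : IsMap g) (h : f ≤ g) : f = g :=
  le_antisymm h (le_of_isAdj hg hf (dag_mono h))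

/-- Maps can be moved to the other side of an inequality. -/
theorem IsMap.comp_le_iff {f : X ⟶ Y} (hf : IsMap f) {g : Y ⟶ Z} {h : X ⟶ Z} :
    dag f ≫ h ≤ g ↔ h ≤ f ≫ g := by
  constructor
  · intro k
    calc h = 𝟙 X ≫ h := (Category.id_comp h).symm
      _ ≤ (f ≫ dag f) ≫ h := comp_mono hf.1 le_rfl
      _ = f ≫ dag f ≫ h := Category.assoc _ _ _
      _ ≤ f ≫ g := comp_mono le_rfl k
  · intro k
    calc dag f ≫ h ≤ dag f ≫ f ≫ g := comp_mono le_rfl k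
      _ = (dag f ≫ f) ≫ g := (Category.assoc _ _ _).symm
      _ ≤ 𝟙 Y ≫ g := comp_mono hf.2 le_rfl
      _ = g := Category.id_comp g

theorem IsMap.le_comp_iff {f : Y ⟶ Z} (hf : IsMap f) {g : X ⟶ Y} {h : X ⟶ Z} :
    g ≫ f ≤ h ↔ g ≤ h ≫ dag f := by
  constructor
  · intro k
    calc g = g ≫ 𝟙 Y := (Category.comp_id g).symm
      _ ≤ g ≫ f ≫ dag f := comp_mono le_rfl hf.1
      _ = (g ≫ f) ≫ dag f := (Category.assoc _ _ _).symm
      _ ≤ h ≫ dag f := comp_mono k le_rfl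
  · intro k
    calc g ≫ f ≤ (h ≫ dag f) ≫ f := comp_mono k le_rfl
      _ = h ≫ dag f ≫ f := Category.assoc _ _ _
      _ ≤ h ≫ 𝟙 Z := comp_mono le_rfl hf.2
      _ = h := Category.comp_id h

/-! ### Tabulations and their universal property -/

/-- A tabulation of `R` is a jointly monic pair of maps `f`, `g` with `R = f† ≫ g`. -/
structure IsTabulation (R : X ⟶ Y) (f : Z ⟶ X) (g : Z ⟶ Y) : Prop where
  left : IsMap f
  right : IsMap g
  eq : dag f ≫ g = R
  jointly_monic : meet (f ≫ dag f) (g ≫ dag g) = 𝟙 Z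

section Tabulation

variable {R : X ⟶ Y} {f : Z ⟶ X} {g : Z ⟶ Y} {u : W ⟶ X} {v : W ⟶ Y}

/-- Agreement after `f` and after `g` puts `dag k' ≫ k` below both `f ≫ dag f` and `g ≫ dag g`,
hence below their meet, which is the identity. -/
theorem IsTabulation.hom_ext (h : IsTabulation R f g) {k k' : W ⟶ Z} (hk : IsMap k)
    (hk' : IsMap k') (hf : k ≫ f = k' ≫ f) (hg : k ≫ g = k' ≫ g) : k = k' := by
  refine IsMap.eq_of_le hk hk' ?_
  have key : dag k' ≫ k ≤ 𝟙 Z := by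
    rw [← h.jointly_monic]
    refine le_meet ?_ ?_
    · rw [← h.left.le_comp_iff, Category.assoc, hf, hk'.comp_le_iff]
    · rw [← h.right.le_comp_iff, Category.assoc, hg, hk'.comp_le_iff]
  simpa using (hk'.comp_le_iff).1 key

theorem IsTabulation.exists_lift (h : IsTabulation R f g) (hu : IsMap u) (hv : IsMap v)
    (hR : dag u ≫ v ≤ R) : ∃ k : W ⟶ Z, IsMap k ∧ k ≫ f = u ∧ k ≫ g = v := by
  -- The largest relation with `k ≫ f ≤ u` and `k ≫ g ≤ v`. Once it is a map, discreteness of the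
  -- order turns both inequalities into equalities.
  let k : W ⟶ Z := meet (u ≫ dag f) (v ≫ dag g)
  have hkf : k ≫ f ≤ u := h.left.le_comp_iff.2 (meet_le_left _ _)
  have hkg : k ≫ g ≤ v := h.right.le_comp_iff.2 (meet_le_right _ _)
  have hk : IsMap k := by
    constructor
    · have h₁ : 𝟙 W ≤ u ≫ dag f ≫ g ≫ dag v := by
        rw [← Category.assoc _ g, h.eq]
        have : v ≤ u ≫ R := hu.comp_le_iff.1 hR
        simpa using hv.le_comp_iff.1 (show 𝟙 W ≫ v ≤ u ≫ R by simpa using this)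
      -- Totality takes two uses of the modular law: the first replaces the right factor of `(u ≫
      -- dag f) ≫ g ≫ dag v` by `dag k`, the second replaces the left factor by something below `k`.
      have h₂ : 𝟙 W ≤ (u ≫ dag f) ≫ meet (g ≫ dag v) (dag (u ≫ dag f) ≫ 𝟙 W) :=
        (le_meet (by simpa using h₁) le_rfl).trans (modular' _ _ _)
      have h₃ : dag k = meet (g ≫ dag v) (dag (u ≫ dag f) ≫ 𝟙 W) := by
        rw [Category.comp_id]
        refine le_antisymm (le_meet ?_ ?_) ?_
        · simpa using dag_mono (meet_le_right (u ≫ dag f) (v ≫ dag g))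
        · exact dag_mono (meet_le_left (u ≫ dag f) (v ≫ dag g))
        · rw [← dag_dag (g ≫ dag v), ← dag_meet]
          refine dag_mono (le_meet (meet_le_right _ _) ?_)
          simpa using meet_le_left (dag (g ≫ dag v)) (u ≫ dag f)
      rw [← h₃] at h₂
      have h₄ : 𝟙 W ≤ meet ((u ≫ dag f) ≫ dag k) (𝟙 W) := le_meet h₂ le_rfl
      have h₅ := h₄.trans (modular _ _ _)
      refine le_of_eq_of_le rfl (h₅.trans (comp_mono ?_ le_rfl))
      simpa using meet_le_right (u ≫ dag f) (𝟙 W ≫ dag (dag k))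
    · rw [← h.jointly_monic]
      refine le_meet ?_ ?_
      · rw [← h.left.le_comp_iff, Category.assoc]
        refine (comp_mono (dag_mono (meet_le_left _ _)) hkf).trans ?_
        simpa using (comp_mono (le_refl f) hu.2)
      · rw [← h.right.le_comp_iff, Category.assoc]
        refine (comp_mono (dag_mono (meet_le_right _ _)) hkg).trans ?_
        simpa using (comp_mono (le_refl g) hv.2)
  exact ⟨k, hk, (hk.comp h.left).eq_of_le hu hkf, (hk.comp h.right).eq_of_le hv hkg⟩

/-- Together with `dag_comp_le_of_comp_eq` this identifies commuting squares over `p` and `q` with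
spans of maps contained in `p ≫ dag q`, so that tabulating this relation gives the pullback. -/
theorem IsTabulation.comp_eq_comp {p : X ⟶ W} {q : Y ⟶ W}
    (h : IsTabulation (p ≫ dag q) f g) (hp : IsMap p) (hq : IsMap q) : f ≫ p = g ≫ q := by
  refine (((h.right.comp hq).eq_of_le (h.left.comp hp)) ?_).symm
  rw [hq.le_comp_iff, Category.assoc, ← h.left.comp_le_iff, h.eq]

theorem dag_comp_le_of_comp_eq {p : X ⟶ Z} {q : Y ⟶ Z} (hu : IsMap u)
    (hq : IsMap q) (e : u ≫ p = v ≫ q) : dag u ≫ v ≤ p ≫ dag q := by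
  rw [hu.comp_le_iff, ← Category.assoc, ← hq.le_comp_iff, e]

end Tabulation

/-- A unit object of an allegory. -/
structure IsUnit (U : A) : Prop where
  le_id (f : U ⟶ U) : f ≤ 𝟙 U
  exists_total (X : A) : ∃ p : X ⟶ U, 𝟙 X ≤ p ≫ dag p

theorem IsUnit.isMap {U : A} (h : IsUnit U) {p : X ⟶ U} (hp : 𝟙 X ≤ p ≫ dag p) : IsMap p :=
  ⟨hp, h.le_id _⟩

/-- The endomorphism `dag q ≫ p` of the unit lies below the identity, and moving `q` across gives `p
≤ q`. -/
theorem IsUnit.eq {U : A} (h : IsUnit U) {p q : X ⟶ U} (hp : IsMap p) (hq : IsMap q) : p = q :=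
  hp.eq_of_le hq (by simpa using hq.comp_le_iff.1 (h.le_id (dag q ≫ p)))

end Allegory

open Allegory Limits

/-! ### The regular category of maps -/

/-- A unitary tabular allegory. -/
class UnitaryTabular (A : Type u) [Category.{v} A] [PoCategory A] [Allegory A] : Prop where
  exists_isUnit : ∃ U : A, IsUnit U
  exists_isTabulation {X Y : A} (R : X ⟶ Y) :
    ∃ (Z : A) (f : Z ⟶ X) (g : Z ⟶ Y), IsTabulation R f g

namespace LAdj

variable {A : Type u} [Category.{v} A] [PoCategory A] {P X Y Z : LAdj A}

theorem hom_ext {f g : X ⟶ Y} (h : f.1 = g.1) : f = g := Subtype.ext h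

theorem comp_val (f : X ⟶ Y) (g : Y ⟶ Z) : (f ≫ g).1 = f.1 ≫ g.1 := rfl

variable [Allegory A]

theorem isMap (f : X ⟶ Y) : IsMap f.1 := isLeftAdj_iff_isMap.1 f.2

/-- The morphism of `LAdj A` given by a map. -/
def ofMap {f : X.obj ⟶ Y.obj} (h : IsMap f) : X ⟶ Y := ⟨f, isLeftAdj_iff_isMap.2 h⟩

/-- A unit of the allegory is a terminal object for the maps. -/
noncomputable def isTerminalOfIsUnit {U : A} (h : IsUnit U) : IsTerminal (⟨U⟩ : LAdj A) :=
  IsTerminal.ofUniqueHom (fun X => ofMap (h.isMap (h.exists_total X.obj).choose_spec))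
    (fun _ m => hom_ext (h.eq (isMap m) (isMap (ofMap _))))

theorem isPullback_of_isTabulation {p : P ⟶ X} {q : P ⟶ Y} {f : X ⟶ Z} {g : Y ⟶ Z}
    (h : IsTabulation (f.1 ≫ dag g.1) p.1 q.1) : IsPullback p q f g := by
  have w : p ≫ f = q ≫ g := hom_ext (h.comp_eq_comp (isMap f) (isMap g))
  have key (s : PullbackCone f g) : ∃ k : s.pt ⟶ P, k ≫ p = s.fst ∧ k ≫ q = s.snd := by
    obtain ⟨k, hk, h₁, h₂⟩ := h.exists_lift (isMap s.fst) (isMap s.snd)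
      (dag_comp_le_of_comp_eq (isMap s.fst) (isMap g) (congrArg Subtype.val s.condition))
    exact ⟨ofMap hk, hom_ext h₁, hom_ext h₂⟩
  choose k hk using key
  exact ⟨⟨w⟩, ⟨PullbackCone.IsLimit.mk w k (fun s => (hk s).1) (fun s => (hk s).2)
    (fun s m h₁ h₂ => hom_ext (h.hom_ext (isMap m) (isMap (k s))
      (congrArg Subtype.val (h₁.trans (hk s).1.symm))
      (congrArg Subtype.val (h₂.trans (hk s).2.symm))))⟩⟩

/-- For a map only `≤` is automatic. For `≥`, the identity equals `dag (e.inv ≫ e.hom) ≫ e.inv ≫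
e.hom`, and the inner `dag e.inv ≫ e.inv` is below the identity. -/
theorem dag_val_comp_val_of_iso (e : X ≅ Y) : dag e.hom.1 ≫ e.hom.1 = 𝟙 Y.obj := by
  refine le_antisymm (isMap e.hom).2 ?_
  have h : e.inv.1 ≫ e.hom.1 = 𝟙 Y.obj := congrArg Subtype.val e.inv_hom_id
  have h' : 𝟙 Y.obj ≤ (dag e.hom.1 ≫ dag e.inv.1) ≫ e.inv.1 ≫ e.hom.1 := by
    rw [h, ← dag_comp, h, dag_id, Category.comp_id]
  refine h'.trans ?_
  have := comp_mono (le_refl (dag e.hom.1)) (comp_mono (isMap e.inv).2 (le_refl e.hom.1))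
  simpa using this

/-- A map `f` with `f† ≫ f = 𝟙` is a coequalizer of every pair `p`, `q` with `p† ≫ q = f ≫ f†`. -/
theorem exists_isColimit {f : X ⟶ Y} (hf : dag f.1 ≫ f.1 = 𝟙 Y.obj) {p q : P ⟶ X}
    (w : p ≫ f = q ≫ f) (h : dag p.1 ≫ q.1 = f.1 ≫ dag f.1) :
    Nonempty (IsColimit (Cofork.ofπ f w)) := by
  have key (s : Cofork p q) : ∃ k : Y ⟶ s.pt, f ≫ k = s.π := by
    -- A map that equalizes `p` and `q` absorbs `dag p ≫ q`, which is the kernel `f ≫ dag f`. Hence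
    -- `dag f ≫ s.π` is a factorization through `f`; it remains to see that it is a map.
    have hs : f.1 ≫ dag f.1 ≫ s.π.1 = s.π.1 := by
      have hpq : p.1 ≫ s.π.1 = q.1 ≫ s.π.1 := congrArg Subtype.val s.condition
      refine le_antisymm ?_ ((isMap f).comp_le_iff.1 le_rfl)
      rw [← Category.assoc, ← h, Category.assoc, ← hpq, (isMap p).comp_le_iff]
    have hk : IsMap (dag f.1 ≫ s.π.1) := by
      constructor
      · rw [dag_comp, dag_dag]
        have := comp_mono (le_refl (dag f.1)) (comp_mono (isMap s.π).1 (le_refl f.1))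
        simpa [hf] using this
      · rw [dag_comp, dag_dag, Category.assoc, hs]
        exact (isMap s.π).2
    exact ⟨ofMap hk, hom_ext hs⟩
  choose k hk using key
  refine ⟨Cofork.IsColimit.mk _ k hk fun s m hm => hom_ext ?_⟩
  have e : f.1 ≫ m.1 = f.1 ≫ (k s).1 := congrArg Subtype.val (hm.trans (hk s).symm)
  simpa [hf, ← Category.assoc] using congrArg (dag f.1 ≫ ·) e

variable [UnitaryTabular A]

theorem exists_isPullback (f : X ⟶ Z) (g : Y ⟶ Z) :
    ∃ (P : LAdj A) (p : P ⟶ X) (q : P ⟶ Y), IsTabulation (f.1 ≫ dag g.1) p.1 q.1 := by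
  obtain ⟨P, p, q, h⟩ := UnitaryTabular.exists_isTabulation (f.1 ≫ dag g.1)
  exact ⟨⟨P⟩, ofMap h.left, ofMap h.right, h⟩

instance : HasFiniteLimits (LAdj A) := by
  have : HasTerminal (LAdj A) :=
    (isTerminalOfIsUnit UnitaryTabular.exists_isUnit.choose_spec).hasTerminal
  have : HasPullbacks (LAdj A) := by
    have (X Y Z : LAdj A) (f : X ⟶ Z) (g : Y ⟶ Z) : HasLimit (cospan f g) := by
      obtain ⟨P, p, q, h⟩ := exists_isPullback f g
      exact (isPullback_of_isTabulation h).hasPullback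
    exact hasPullbacks_of_hasLimit_cospan _
  exact hasFiniteLimits_of_hasTerminal_and_pullbacks

/-- The Beck–Chevalley condition. It is part of the definition for the pullback obtained by
tabulation, and any other pullback differs from that one by an isomorphism, which cancels against
its converse. -/
theorem dag_comp_eq_of_isPullback {p : P ⟶ X} {q : P ⟶ Y} {f : X ⟶ Z} {g : Y ⟶ Z}
    (h : IsPullback p q f g) : dag p.1 ≫ q.1 = f.1 ≫ dag g.1 := by
  obtain ⟨P', p', q', h'⟩ := exists_isPullback f g
  let e := h.isoIsPullback _ _ (isPullback_of_isTabulation h')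
  have hp : e.hom.1 ≫ p'.1 = p.1 :=
    congrArg Subtype.val (h.isoIsPullback_hom_fst _ _ (isPullback_of_isTabulation h'))
  have hq : e.hom.1 ≫ q'.1 = q.1 :=
    congrArg Subtype.val (h.isoIsPullback_hom_snd _ _ (isPullback_of_isTabulation h'))
  have he := dag_val_comp_val_of_iso e
  rw [← h'.eq, ← hp, ← hq, dag_comp, Category.assoc, ← Category.assoc (dag e.hom.1), he,
    Category.id_comp]

/-- Every coreflexive splits through a monic map. -/
theorem exists_image (f : X ⟶ Y) : ∃ (I : LAdj A) (e : X ⟶ I) (m : I ⟶ Y),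
    e ≫ m = f ∧ Mono m ∧ dag e.1 ≫ e.1 = 𝟙 I.obj := by
  obtain ⟨I, m, n, h⟩ := UnitaryTabular.exists_isTabulation (dag f.1 ≫ f.1)
  -- Since `dag f ≫ f` is below the identity, the legs of its tabulation are comparable maps and so
  -- coincide. Joint monicity then says that this single leg is split by its converse.
  obtain rfl : n = m := h.right.eq_of_le h.left (by
    simpa using h.left.comp_le_iff.1 (h.eq.trans_le (isMap f).2))
  have hm : n ≫ dag n = 𝟙 I :=
    le_antisymm ((le_meet le_rfl le_rfl).trans_eq h.jointly_monic) h.left.1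
  obtain ⟨e, he, hf, -⟩ := h.exists_lift (isMap f) (isMap f) le_rfl
  have h' : e = f.1 ≫ dag n := by rw [← hf, Category.assoc, hm, Category.comp_id]
  refine ⟨⟨I⟩, ofMap he, ofMap h.left, hom_ext hf, ⟨fun a b w => hom_ext ?_⟩, ?_⟩
  · have w : a.1 ≫ n = b.1 ≫ n := congrArg Subtype.val w
    simpa [hm] using congrArg (· ≫ dag n) w
  · change dag e ≫ e = 𝟙 I
    have : dag e ≫ e = n ≫ (dag f.1 ≫ f.1) ≫ dag n := by simp [h']
    rw [this, ← h.eq, Category.assoc, hm, Category.comp_id, hm]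

/-- If `f` is a regular epimorphism, then the monic part of its image factorization is also a strong
epimorphism, hence invertible. Conversely `f` is the coequalizer of its kernel pair, the tabulation
of `f ≫ dag f`. -/
theorem isRegularEpi_iff (f : X ⟶ Y) : IsRegularEpi f ↔ dag f.1 ≫ f.1 = 𝟙 Y.obj := by
  constructor
  · intro hf
    obtain ⟨I, e, m, rfl, hm, he⟩ := exists_image f
    have : StrongEpi m := strongEpi_of_strongEpi e m
    have : IsIso m := isIso_of_mono_of_strongEpi m
    have hm := dag_val_comp_val_of_iso (asIso m)
    rw [comp_val, dag_comp, Category.assoc, ← Category.assoc (dag e.1), he, Category.id_comp]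
    exact hm
  · intro hf
    obtain ⟨P, p, q, h⟩ := exists_isPullback f f
    obtain ⟨h⟩ := exists_isColimit hf (hom_ext (h.comp_eq_comp (isMap f) (isMap f))) h.eq
    exact ⟨⟨⟨P, p, q, _, h⟩⟩⟩

/-- The maps in a unitary tabular allegory form a regular category. -/
instance regular : Regular (LAdj A) where
  hasCoequalizer_of_isKernelPair {X Y P f p q} h := by
    -- Since `m` is monic, a kernel pair of `e ≫ m` is one of `e`, and `e` is its coequalizer.
    obtain ⟨I, e, m, rfl, hm, he⟩ := exists_image f
    have w : p ≫ e = q ≫ e := by simpa [← cancel_mono m] using h.w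
    obtain ⟨h'⟩ := exists_isColimit he w (dag_comp_eq_of_isPullback (h.cancel_right w))
    exact ⟨⟨_, h'⟩⟩
  regularEpiIsStableUnderBaseChange := by
    refine ⟨fun {X Y P Z f g q p} sq hg => ?_⟩
    rw [MorphismProperty.regularEpi_iff, isRegularEpi_iff] at hg ⊢
    have h := dag_comp_eq_of_isPullback sq
    -- Beck–Chevalley rewrites the right side as `f ≫ dag g ≫ g ≫ dag f`, which is `f ≫ dag f`
    -- because `g` is a regular epimorphism. The modular law below then extracts `𝟙 ≤ dag p ≫ p`.
    have h₁ : 𝟙 X.obj ≤ dag p.1 ≫ q.1 ≫ dag q.1 ≫ p.1 := by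
      have h' : dag p.1 ≫ q.1 = f.1 ≫ dag g.1 := by simpa using congrArg dag h
      rw [h, ← Category.assoc, h', Category.assoc, ← Category.assoc (dag g.1), hg,
        Category.id_comp]
      exact (isMap f).1
    refine le_antisymm (isMap p).2 ?_
    refine ((le_meet h₁ le_rfl).trans (modular' _ _ _)).trans (comp_mono le_rfl ?_)
    simpa using meet_le_right (q.1 ≫ dag q.1 ≫ p.1) (dag (dag p.1) ≫ 𝟙 X.obj)

end LAdj

/-! ### Functors of unitary allegories -/

/-- A functor of unitary allegories: it preserves the order, the involution, the meets and the
unit. -/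
structure IsUnitaryFunctor {A B : Type*} [Category* A] [PoCategory A] [Allegory A] [Category* B]
    [PoCategory B] [Allegory B] (H : A ⥤ B) : Prop where
  map_mono {X Y : A} {f g : X ⟶ Y} : f ≤ g → H.map f ≤ H.map g
  map_dag {X Y : A} (f : X ⟶ Y) : H.map (dag f) = dag (H.map f)
  map_meet {X Y : A} (f g : X ⟶ Y) : H.map (meet f g) = meet (H.map f) (H.map g)
  exists_isUnit : ∃ U : A, IsUnit U ∧ IsUnit (H.obj U)

namespace IsUnitaryFunctor

variable {A B : Type*} [Category* A] [PoCategory A] [Allegory A] [Category* B]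
  [PoCategory B] [Allegory B] {H : A ⥤ B}

theorem isMap_map (hH : IsUnitaryFunctor H) {X Y : A} {f : X ⟶ Y} (h : IsMap f) :
    IsMap (H.map f) := by
  have h₁ := hH.map_mono h.1
  have h₂ := hH.map_mono h.2
  rw [H.map_comp, H.map_id, hH.map_dag] at h₁ h₂
  exact ⟨h₁, h₂⟩

/-- Tabulations are defined by equations and inequalities in the preserved operations. This is what
makes the induced functor on maps preserve pullbacks. -/
theorem isTabulation_map (hH : IsUnitaryFunctor H) {X Y Z : A} {R : X ⟶ Y} {f : Z ⟶ X} {g : Z ⟶ Y}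
    (h : IsTabulation R f g) : IsTabulation (H.map R) (H.map f) (H.map g) where
  left := hH.isMap_map h.left
  right := hH.isMap_map h.right
  eq := by rw [← hH.map_dag, ← H.map_comp, h.eq]
  jointly_monic := by
    rw [← hH.map_dag, ← hH.map_dag, ← H.map_comp, ← H.map_comp, ← hH.map_meet, h.jointly_monic,
      H.map_id]

/-- The functor between the categories of maps that is induced by a functor of unitary
allegories. -/
def mapLAdj (hH : IsUnitaryFunctor H) : LAdj A ⥤ LAdj B where
  obj X := ⟨H.obj X.obj⟩
  map f := LAdj.ofMap (hH.isMap_map (LAdj.isMap f))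
  map_id X := LAdj.hom_ext (H.map_id X.obj)
  map_comp f g := LAdj.hom_ext (H.map_comp f.1 g.1)

theorem map_isRegularEpi (hH : IsUnitaryFunctor H) [UnitaryTabular A] [UnitaryTabular B]
    {X Y : LAdj A} (f : X ⟶ Y) (hf : IsRegularEpi f) : IsRegularEpi (hH.mapLAdj.map f) := by
  rw [LAdj.isRegularEpi_iff] at hf ⊢
  change dag (H.map f.1) ≫ H.map f.1 = 𝟙 (H.obj Y.obj)
  rw [← hH.map_dag, ← H.map_comp, hf, H.map_id]

theorem preservesFiniteLimits (hH : IsUnitaryFunctor H) [UnitaryTabular A] :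
    PreservesFiniteLimits hH.mapLAdj := by
  have : PreservesLimit (Functor.empty (LAdj A)) hH.mapLAdj := by
    obtain ⟨U, hU, hU'⟩ := hH.exists_isUnit
    refine preservesLimit_of_preserves_limit_cone (LAdj.isTerminalOfIsUnit hU) ?_
    exact (isLimitMapConeEmptyConeEquiv _ _).symm (LAdj.isTerminalOfIsUnit hU')
  have : PreservesLimitsOfShape (Discrete PEmpty.{1}) hH.mapLAdj :=
    preservesLimitsOfShape_pempty_of_preservesTerminal _
  have : PreservesLimitsOfShape WalkingCospan hH.mapLAdj := by
    refine ⟨fun {K} => ?_⟩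
    have (X Y Z : LAdj A) (f : X ⟶ Z) (g : Y ⟶ Z) : PreservesLimit (cospan f g) hH.mapLAdj := by
      obtain ⟨P, p, q, h⟩ := LAdj.exists_isPullback f g
      have h' : IsTabulation ((hH.mapLAdj.map f).1 ≫ dag (hH.mapLAdj.map g).1)
          (hH.mapLAdj.map p).1 (hH.mapLAdj.map q).1 := by
        have := hH.isTabulation_map h
        rwa [H.map_comp, hH.map_dag] at this
      have sq := LAdj.isPullback_of_isTabulation h
      have sq' := LAdj.isPullback_of_isTabulation h'
      refine preservesLimit_of_preserves_limit_cone sq.isLimit ?_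
      exact (isLimitMapConePullbackConeEquiv _ sq.w).symm sq'.isLimit
    exact preservesLimit_of_iso_diagram _ (diagramIsoCospan K).symm
  exact preservesFiniteLimits_of_preservesTerminal_and_pullbacks _

end IsUnitaryFunctor

/-! ### Conjunctive queries in a regular calculus -/

namespace Ctx

variable {T : Type u} {Γ Δ Θ Λ : Ctx T}

theorem graph_lift_eq (m : Θ ⟶ Γ) (n : Θ ⟶ Δ) :
    graph (lift m n) = relComp (graph (diag Θ)) (relTensor (graph m) (graph n)) := by
  refine SubObj.ext_holds (Finset.ext fun t => ?_) ?_
  · simp only [mem_relComp_supp, mem_relTensor_supp, graph_supp]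
    tauto
  · simp only [forall_copair, exists_copair, holds_relComp, holds_relTensor, holds_graph,
      copair_inj, diag, comp_lift_fn, id_fn, Function.comp_id]
    grind

end Ctx

namespace RgCalc

variable {C : RgCalc.{u, v}} {Γ Δ Θ Λ : Ctx C.T}

/-- The action of relations between contexts on predicates. -/
def ap (A : Ctx.Rel Γ Δ) (x : C.P.obj ⟨Γ⟩) : C.P.obj ⟨Δ⟩ := C.act (X := ⟨Γ⟩) (Y := ⟨Δ⟩) A x

/-- Juxtaposition of predicates in contexts. -/
noncomputable def jx (x : C.P.obj ⟨Γ⟩) (y : C.P.obj ⟨Δ⟩) : C.P.obj ⟨Ctx.sum Γ Δ⟩ := C.juxt x y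

@[simp]
theorem ap_id (x : C.P.obj ⟨Γ⟩) : ap (Ctx.graph (𝟙 Γ)) x = x := C.act_id x

@[simp]
theorem ap_ap (A : Ctx.Rel Γ Δ) (B : Ctx.Rel Δ Θ) (x : C.P.obj ⟨Γ⟩) :
    ap B (ap A x) = ap (Ctx.relComp A B) x := (C.act_comp (X := ⟨Γ⟩) (Y := ⟨Δ⟩) (Z := ⟨Θ⟩) A B x).symm

theorem ap_mono {A B : Ctx.Rel Γ Δ} (h : A ≤ B) {x y : C.P.obj ⟨Γ⟩} (h' : x ≤ y) :
    ap A x ≤ ap B y := C.act_mono (X := ⟨Γ⟩) (Y := ⟨Δ⟩) h h'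

theorem jx_mono {x x' : C.P.obj ⟨Γ⟩} {y y' : C.P.obj ⟨Δ⟩} (h : x ≤ x') (h' : y ≤ y') :
    jx x y ≤ jx x' y' := C.juxt_mono h h'

theorem ap_jx {Γ' Δ' : Ctx C.T} (A : Ctx.Rel Γ Δ) (B : Ctx.Rel Γ' Δ') (x : C.P.obj ⟨Γ⟩)
    (y : C.P.obj ⟨Γ'⟩) : jx (ap A x) (ap B y) = ap (Ctx.relTensor A B) (jx x y) :=
  (C.act_juxt (X := ⟨Γ⟩) (Y := ⟨Γ'⟩) (Z := ⟨Δ⟩) (W := ⟨Δ'⟩) A B x y).symm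

theorem ap_jx_left (A : Ctx.Rel Γ Δ) (x : C.P.obj ⟨Γ⟩) (y : C.P.obj ⟨Θ⟩) :
    jx (ap A x) y = ap (Ctx.relTensor A (Ctx.graph (𝟙 Θ))) (jx x y) := by
  rw [← ap_jx, ap_id]

theorem ap_jx_right (A : Ctx.Rel Γ Δ) (x : C.P.obj ⟨Γ⟩) (y : C.P.obj ⟨Θ⟩) :
    jx y (ap A x) = ap (Ctx.relTensor (Ctx.graph (𝟙 Θ)) A) (jx y x) := by
  rw [← ap_jx, ap_id]

/-- The predicate `x` holds of the image under `m` of whatever satisfies `z`. -/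
def Forces (z : C.P.obj ⟨Θ⟩) (m : Θ ⟶ Γ) (x : C.P.obj ⟨Γ⟩) : Prop := ap (Ctx.graph m) z ≤ x

theorem forces_id (z : C.P.obj ⟨Θ⟩) : Forces z (𝟙 Θ) z := (ap_id z).le

theorem Forces.trans {z : C.P.obj ⟨Θ⟩} {x : C.P.obj ⟨Γ⟩} {y : C.P.obj ⟨Δ⟩} {m : Θ ⟶ Γ}
    {n : Γ ⟶ Δ} (h : Forces z m x) (h' : Forces x n y) : Forces z (m ≫ n) y := by
  rw [Forces, Ctx.graph_comp, ← ap_ap]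
  exact (ap_mono le_rfl h).trans h'

theorem forces_fst (x : C.P.obj ⟨Γ⟩) (y : C.P.obj ⟨Δ⟩) : Forces (jx x y) (Ctx.fst Γ Δ) x :=
  C.push_fst_juxt x y

theorem forces_snd (x : C.P.obj ⟨Γ⟩) (y : C.P.obj ⟨Δ⟩) : Forces (jx x y) (Ctx.snd Γ Δ) y :=
  C.push_snd_juxt x y

/-- Duplicating `z` along the diagonal lands below `jx z z`: it lies below a juxtaposition with `z`
on the left and below one with `z` on the right, and a right adjoint laxator allows the two bounds
to be combined. This lets a query homomorphism reuse a term on the left. -/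
theorem Forces.lift {z : C.P.obj ⟨Θ⟩} {x : C.P.obj ⟨Γ⟩} {y : C.P.obj ⟨Δ⟩} {m : Θ ⟶ Γ}
    {n : Θ ⟶ Δ} (h : Forces z m x) (h' : Forces z n y) : Forces z (Ctx.lift m n) (jx x y) := by
  have hd : ap (Ctx.graph (Ctx.diag Θ)) z ≤ jx z z := by
    obtain ⟨y', hy⟩ := C.push_diag_le_left (le_refl z)
    obtain ⟨x', hx⟩ := C.push_diag_le_right (le_refl z)
    exact C.le_juxt hy hx
  rw [Forces, Ctx.graph_lift_eq, ← ap_ap]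
  refine (ap_mono le_rfl hd).trans ?_
  rw [← ap_jx]
  exact jx_mono h h'

/-- An inequality of conjunctive queries follows from a homomorphism of queries. -/
theorem ap_le_ap {z : C.P.obj ⟨Θ⟩} {x : C.P.obj ⟨Γ⟩} {m : Θ ⟶ Γ} (h : Forces z m x)
    {A : Ctx.Rel Θ Λ} {B : Ctx.Rel Γ Λ} (hAB : A ≤ Ctx.relComp (Ctx.graph m) B) :
    ap A z ≤ ap B x :=
  (ap_mono hAB le_rfl).trans ((ap_ap _ _ z).symm.trans_le (ap_mono le_rfl h))

theorem compTerm_eq (θ : C.P.obj ⟨Ctx.sum Γ Δ⟩) (θ' : C.P.obj ⟨Ctx.sum Δ Θ⟩) :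
    C.compTerm θ θ' = ap (Ctx.compRel Γ Δ Θ) (jx θ θ') := rfl

theorem idTerm_eq (φ : C.P.obj ⟨Γ⟩) : C.idTerm φ = ap (Ctx.graph (Ctx.diag Γ)) φ := rfl

/-- The converse of an internal relation. -/
noncomputable def dagTerm (θ : C.P.obj ⟨Ctx.sum Γ Δ⟩) : C.P.obj ⟨Ctx.sum Δ Γ⟩ :=
  ap (Ctx.graph (Ctx.swapIso Γ Δ).hom) θ

/-- The meet of two predicates. -/
noncomputable def meetTerm (x y : C.P.obj ⟨Γ⟩) : C.P.obj ⟨Γ⟩ :=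
  ap (Ctx.cograph (Ctx.diag Γ)) (jx x y)

theorem le_meetTerm {x y z : C.P.obj ⟨Γ⟩} (h : z ≤ x) (h' : z ≤ y) : z ≤ meetTerm x y :=
  C.le_meet h h'

theorem meetTerm_le_left (x y : C.P.obj ⟨Γ⟩) : meetTerm x y ≤ x := by
  conv_rhs => rw [← ap_id x]
  refine ap_le_ap (forces_fst x y) (Ctx.SubObj.le_of_holds (fun t => ?_) ?_)
  · simp only [Ctx.mem_relComp_supp, Ctx.graph_supp, Ctx.cograph_supp, Ctx.mem_supp_sum]
    tauto
  · simp only [Ctx.forall_copair, Ctx.holds_relComp, Ctx.holds_graph, Ctx.holds_cograph,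
      Ctx.copair_inj, Ctx.diag, Ctx.comp_lift_fn, Ctx.id_fn, Function.comp_id,
      Ctx.copair_comp_fst]
    grind

theorem meetTerm_le_right (x y : C.P.obj ⟨Γ⟩) : meetTerm x y ≤ y := by
  conv_rhs => rw [← ap_id y]
  refine ap_le_ap (forces_snd x y) (Ctx.SubObj.le_of_holds (fun t => ?_) ?_)
  · simp only [Ctx.mem_relComp_supp, Ctx.graph_supp, Ctx.cograph_supp, Ctx.mem_supp_sum]
    tauto
  · simp only [Ctx.forall_copair, Ctx.holds_relComp, Ctx.holds_graph, Ctx.holds_cograph,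
      Ctx.copair_inj, Ctx.diag, Ctx.comp_lift_fn, Ctx.id_fn, Function.comp_id,
      Ctx.copair_comp_snd]
    grind

theorem dagTerm_dagTerm (θ : C.P.obj ⟨Ctx.sum Γ Δ⟩) : dagTerm (dagTerm θ) = θ := by
  rw [dagTerm, dagTerm, ap_ap, ← Ctx.graph_comp]
  exact (congrArg (fun f => ap (Ctx.graph f) θ) (Ctx.swapIso Γ Δ).hom_inv_id).trans (ap_id θ)

theorem dagTerm_mono {θ θ' : C.P.obj ⟨Ctx.sum Γ Δ⟩} (h : θ ≤ θ') : dagTerm θ ≤ dagTerm θ' :=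
  ap_mono le_rfl h

theorem dagTerm_compTerm_le (θ : C.P.obj ⟨Ctx.sum Γ Δ⟩) (θ' : C.P.obj ⟨Ctx.sum Δ Θ⟩) :
    dagTerm (C.compTerm θ θ') ≤ C.compTerm (dagTerm θ') (dagTerm θ) := by
  simp only [compTerm_eq, dagTerm, ap_jx_left, ap_jx_right, ap_ap]
  -- The homomorphism exchanges the two terms, which occur in the opposite order on the right.
  refine ap_le_ap ((forces_snd θ θ').lift (forces_fst θ θ'))
    (Ctx.SubObj.le_of_holds (fun t => ?_) ?_)
  · simp only [Ctx.compRel_supp, Ctx.mem_relComp_supp, Ctx.mem_relTensor_supp, Ctx.graph_supp,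
      Ctx.mem_supp_sum]
    tauto
  · simp only [Ctx.forall_copair, Ctx.exists_copair, Ctx.holds_relComp, Ctx.holds_relTensor,
      Ctx.holds_compRel, Ctx.holds_graph, Ctx.copair_inj, Ctx.swapIso, Ctx.comp_lift_fn, Ctx.id_fn,
      Function.comp_id, Ctx.copair_comp_fst, Ctx.copair_comp_snd]
    grind

/-- The reverse inequality is the first one for the converses, with the involution applied to both
sides. -/
theorem dagTerm_compTerm (θ : C.P.obj ⟨Ctx.sum Γ Δ⟩) (θ' : C.P.obj ⟨Ctx.sum Δ Θ⟩) :
    dagTerm (C.compTerm θ θ') = C.compTerm (dagTerm θ') (dagTerm θ) := by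
  refine le_antisymm (dagTerm_compTerm_le θ θ') ?_
  have := dagTerm_mono (dagTerm_compTerm_le (dagTerm θ') (dagTerm θ))
  simpa only [dagTerm_dagTerm] using this

/-- The modular law. The left query asserts `θ(x, y)`, `θ'(y, z)` and `χ(x, z)`; the same `y` and
`z` witness the inner composite `C.compTerm χ (dagTerm θ')` on the right. -/
theorem meetTerm_compTerm_le (θ : C.P.obj ⟨Ctx.sum Γ Δ⟩) (θ' : C.P.obj ⟨Ctx.sum Δ Θ⟩)
    (χ : C.P.obj ⟨Ctx.sum Γ Θ⟩) :
    meetTerm (C.compTerm θ θ') χ ≤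
      C.compTerm (meetTerm θ (C.compTerm χ (dagTerm θ'))) θ' := by
  simp only [compTerm_eq, dagTerm, meetTerm, ap_jx_left, ap_jx_right, ap_ap]
  have h₁ := (forces_fst (jx θ θ') χ).trans (forces_fst θ θ')
  have h₂ := (forces_fst (jx θ θ') χ).trans (forces_snd θ θ')
  have h₃ := forces_snd (jx θ θ') χ
  -- The terms on the right occur in the order `θ`, `χ`, `θ'`, `θ'`, so `h₂` is used twice.
  refine ap_le_ap ((h₁.lift (h₃.lift h₂)).lift h₂) (Ctx.SubObj.le_of_holds (fun t => ?_) ?_)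
  · simp only [Ctx.compRel_supp, Ctx.mem_relComp_supp, Ctx.mem_relTensor_supp, Ctx.graph_supp,
      Ctx.cograph_supp, Ctx.mem_supp_sum]
    tauto
  · simp only [Ctx.forall_copair, Ctx.exists_copair, Ctx.holds_relComp, Ctx.holds_relTensor,
      Ctx.holds_compRel, Ctx.holds_graph, Ctx.holds_cograph, Ctx.copair_inj, Ctx.diag, Ctx.swapIso,
      Ctx.comp_lift_fn, Ctx.comp_comp_fn, Ctx.id_fn, Function.comp_id, Ctx.copair_comp_fst,
      Ctx.copair_comp_snd]
    grind

/-- The graph of a morphism `h` of contexts, restricted to a predicate. -/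
noncomputable def graphTerm (h : Γ ⟶ Δ) (φ : C.P.obj ⟨Γ⟩) : C.P.obj ⟨Ctx.sum Γ Δ⟩ :=
  ap (Ctx.graph (Ctx.lift (𝟙 Γ) h)) φ

theorem isIntRel_graphTerm {h : Γ ⟶ Δ} {φ : C.P.obj ⟨Γ⟩} {ψ : C.P.obj ⟨Δ⟩}
    (hφ : Forces φ h ψ) : C.IsIntRel φ ψ (graphTerm h φ) := by
  constructor
  · change ap (Ctx.graph (Ctx.fst Γ Δ)) (graphTerm h φ) ≤ φ
    rw [graphTerm, ap_ap, ← Ctx.graph_comp, Ctx.lift_fst, ap_id]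
  · change ap (Ctx.graph (Ctx.snd Γ Δ)) (graphTerm h φ) ≤ ψ
    rw [graphTerm, ap_ap, ← Ctx.graph_comp, Ctx.lift_snd]
    exact hφ

theorem idTerm_le_graphTerm (h : Γ ⟶ Δ) (φ : C.P.obj ⟨Γ⟩) :
    C.idTerm φ ≤ C.compTerm (graphTerm h φ) (dagTerm (graphTerm h φ)) := by
  simp only [compTerm_eq, idTerm_eq, dagTerm, graphTerm, ap_jx_left, ap_jx_right, ap_ap]
  refine ap_le_ap ((forces_id φ).lift (forces_id φ)) (Ctx.SubObj.le_of_holds (fun t => ?_) ?_)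
  -- The wiring on the right also has the support of `Δ`. It is contained in that of `Γ` because `h`
  -- is a morphism of contexts.
  · have := @h.supp_le t
    simp only [Ctx.compRel_supp, Ctx.mem_relComp_supp, Ctx.mem_relTensor_supp, Ctx.graph_supp,
      Ctx.mem_supp_sum]
    tauto
  · simp only [Ctx.forall_copair, Ctx.exists_copair, Ctx.holds_relComp, Ctx.holds_relTensor,
      Ctx.holds_compRel, Ctx.holds_graph, Ctx.copair_inj, Ctx.diag, Ctx.swapIso, Ctx.comp_lift_fn,
      Ctx.id_fn, Function.comp_id, Ctx.copair_comp_fst, Ctx.copair_comp_snd]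
    grind

theorem graphTerm_le_idTerm {h : Γ ⟶ Δ} {φ : C.P.obj ⟨Γ⟩} {ψ : C.P.obj ⟨Δ⟩}
    (hφ : Forces φ h ψ) :
    C.compTerm (dagTerm (graphTerm h φ)) (graphTerm h φ) ≤ C.idTerm ψ := by
  simp only [compTerm_eq, idTerm_eq, dagTerm, graphTerm, ap_jx_left, ap_jx_right, ap_ap]
  -- The query on the left has two copies of `φ` at the same point `x`; the point `h x` witnesses
  -- `ψ` on the right.
  refine ap_le_ap ((forces_fst φ φ).trans hφ) (Ctx.SubObj.le_of_holds (fun t => ?_) ?_)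
  · have := @h.supp_le t
    simp only [Ctx.compRel_supp, Ctx.mem_relComp_supp, Ctx.mem_relTensor_supp, Ctx.graph_supp,
      Ctx.mem_supp_sum]
    tauto
  · simp only [Ctx.forall_copair, Ctx.exists_copair, Ctx.holds_relComp, Ctx.holds_relTensor,
      Ctx.holds_compRel, Ctx.holds_graph, Ctx.copair_inj, Ctx.diag, Ctx.swapIso, Ctx.comp_lift_fn,
      Ctx.comp_comp_fn, Ctx.id_fn, Function.comp_id, Ctx.copair_comp_fst, Ctx.copair_comp_snd]
    grind

/-- The composite asserts `θ` twice at one pair of points and reads off its two coordinates. One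
inequality forgets a copy of `θ`, the other duplicates `θ`. -/
theorem graphTerm_fst_snd (θ : C.P.obj ⟨Ctx.sum Γ Δ⟩) :
    C.compTerm (dagTerm (graphTerm (Ctx.fst Γ Δ) θ)) (graphTerm (Ctx.snd Γ Δ) θ) = θ := by
  refine le_antisymm ?_ ?_
  · conv_rhs => rw [← ap_id θ]
    simp only [compTerm_eq, dagTerm, graphTerm, ap_jx_left, ap_jx_right, ap_ap]
    refine ap_le_ap (forces_fst θ θ) (Ctx.SubObj.le_of_holds (fun t => ?_) ?_)
    · simp only [Ctx.compRel_supp, Ctx.mem_relComp_supp, Ctx.mem_relTensor_supp, Ctx.graph_supp,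
        Ctx.mem_supp_sum]
      tauto
    · simp only [Ctx.forall_copair, Ctx.exists_copair, Ctx.holds_relComp, Ctx.holds_relTensor,
        Ctx.holds_compRel, Ctx.holds_graph, Ctx.copair_inj, Ctx.swapIso, Ctx.comp_lift_fn,
        Ctx.id_fn, Function.comp_id, Ctx.copair_comp_fst, Ctx.copair_comp_snd]
      grind
  · conv_lhs => rw [← ap_id θ]
    simp only [compTerm_eq, dagTerm, graphTerm, ap_jx_left, ap_jx_right, ap_ap]
    refine ap_le_ap ((forces_id θ).lift (forces_id θ)) (Ctx.SubObj.le_of_holds (fun t => ?_) ?_)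
    · simp only [Ctx.compRel_supp, Ctx.mem_relComp_supp, Ctx.mem_relTensor_supp, Ctx.graph_supp,
        Ctx.mem_supp_sum]
      tauto
    · simp only [Ctx.forall_copair, Ctx.exists_copair, Ctx.holds_relComp, Ctx.holds_relTensor,
        Ctx.holds_compRel, Ctx.holds_graph, Ctx.copair_inj, Ctx.swapIso, Ctx.comp_lift_fn,
        Ctx.id_fn, Function.comp_id, Ctx.copair_comp_fst, Ctx.copair_comp_snd]
      grind

/-- Joint monicity of the projections: two points of `Γ ⊕ Δ` with the same first and the same second
coordinates are equal. Any one of the four copies of `θ` serves as witness; the first is chosen. -/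
theorem meetTerm_graphTerm_le (θ : C.P.obj ⟨Ctx.sum Γ Δ⟩) :
    meetTerm
      (C.compTerm (graphTerm (Ctx.fst Γ Δ) θ) (dagTerm (graphTerm (Ctx.fst Γ Δ) θ)))
      (C.compTerm (graphTerm (Ctx.snd Γ Δ) θ) (dagTerm (graphTerm (Ctx.snd Γ Δ) θ))) ≤
      C.idTerm θ := by
  simp only [compTerm_eq, idTerm_eq, dagTerm, graphTerm, meetTerm, ap_jx_left, ap_jx_right, ap_ap]
  refine ap_le_ap ((forces_fst _ _).trans (forces_fst _ _))
    (Ctx.SubObj.le_of_holds (fun t => ?_) ?_)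
  · simp only [Ctx.compRel_supp, Ctx.mem_relComp_supp, Ctx.mem_relTensor_supp, Ctx.graph_supp,
      Ctx.cograph_supp, Ctx.mem_supp_sum]
    tauto
  · simp only [Ctx.forall_copair, Ctx.exists_copair, Ctx.holds_relComp, Ctx.holds_relTensor,
      Ctx.holds_compRel, Ctx.holds_graph, Ctx.holds_cograph, Ctx.copair_inj, Ctx.diag, Ctx.swapIso,
      Ctx.comp_lift_fn, Ctx.comp_comp_fn, Ctx.id_fn, Function.comp_id, Ctx.copair_comp_fst,
      Ctx.copair_comp_snd]
    grind

theorem forces_star (z : C.P.obj ⟨Γ⟩) : Forces z (Ctx.toZero Γ) C.star := C.le_star _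

/-- The empty context has no ports, so the wirings impose no equations, and `C.star` is the top
predicate because the unit laxator is a right adjoint. -/
theorem le_idTerm_star (θ : C.P.obj ⟨Ctx.sum (Ctx.zero C.T) (Ctx.zero C.T)⟩) :
    θ ≤ C.idTerm C.star := by
  conv_lhs => rw [← ap_id θ]
  rw [idTerm_eq]
  refine ap_le_ap (forces_star θ) (Ctx.SubObj.le_of_holds (fun t => ?_) ?_)
  · simp only [Ctx.mem_relComp_supp, Ctx.graph_supp, Ctx.mem_supp_sum]
    tauto
  · simp only [Ctx.forall_copair, Ctx.holds_relComp, Ctx.holds_graph,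
      Ctx.copair_inj, Ctx.diag, Ctx.comp_lift_fn, Ctx.id_fn, Function.comp_id, Ctx.point_zero_iff]
    simp

end RgCalc

/-! ### The unitary tabular allegory of internal relations -/

open Allegory RgCalc

noncomputable instance (C : RgCalc.{u, v}) : Allegory (IntRel C) where
  dag {X Y} θ := ⟨dagTerm θ.1, by
    have e₁ : ap (Ctx.graph (Ctx.fst Y.ctx X.ctx)) (dagTerm θ.1) =
        ap (Ctx.graph (Ctx.snd X.ctx Y.ctx)) θ.1 := by
      rw [dagTerm, ap_ap, ← Ctx.graph_comp, Ctx.swapIso, Ctx.lift_fst]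
    have e₂ : ap (Ctx.graph (Ctx.snd Y.ctx X.ctx)) (dagTerm θ.1) =
        ap (Ctx.graph (Ctx.fst X.ctx Y.ctx)) θ.1 := by
      rw [dagTerm, ap_ap, ← Ctx.graph_comp, Ctx.swapIso, Ctx.lift_snd]
    exact ⟨e₁.trans_le θ.2.2, e₂.trans_le θ.2.1⟩⟩
  dag_dag θ := Subtype.ext (dagTerm_dagTerm θ.1)
  dag_comp θ θ' := Subtype.ext (dagTerm_compTerm θ.1 θ'.1)
  dag_mono h := dagTerm_mono h
  meet {X Y} θ θ' := ⟨meetTerm θ.1 θ'.1,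
    (ap_mono le_rfl (meetTerm_le_left θ.1 θ'.1)).trans θ.2.1,
    (ap_mono le_rfl (meetTerm_le_left θ.1 θ'.1)).trans θ.2.2⟩
  meet_le_left θ θ' := meetTerm_le_left θ.1 θ'.1
  meet_le_right θ θ' := meetTerm_le_right θ.1 θ'.1
  le_meet h h' := le_meetTerm h h'
  modular θ θ' χ := meetTerm_compTerm_le θ.1 θ'.1 χ.1

namespace IntRel

variable {C : RgCalc.{u, v}}

/-- The internal function given by a morphism of contexts. -/
noncomputable def ofHom {X Y : IntRel C} (h : X.ctx ⟶ Y.ctx) (hX : Forces X.pred h Y.pred) :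
    X ⟶ Y := ⟨graphTerm h X.pred, isIntRel_graphTerm hX⟩

theorem isMap_ofHom {X Y : IntRel C} (h : X.ctx ⟶ Y.ctx) (hX : Forces X.pred h Y.pred) :
    IsMap (ofHom h hX) :=
  ⟨idTerm_le_graphTerm h X.pred, graphTerm_le_idTerm hX⟩

theorem isUnit_zero (C : RgCalc.{u, v}) : IsUnit (⟨Ctx.zero C.T, C.star⟩ : IntRel C) where
  le_id θ := le_idTerm_star θ.1
  exists_total X := ⟨ofHom (Ctx.toZero X.ctx) (forces_star X.pred), (isMap_ofHom _ _).1⟩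

/-- The apex is the comprehension of `θ`. The two conditions that make `θ` an internal relation say
precisely that the projections land in `X` and `Y`. -/
theorem isTabulation {X Y : IntRel C} (θ : X ⟶ Y) :
    IsTabulation (Z := (⟨Ctx.sum X.ctx Y.ctx, θ.1⟩ : IntRel C)) θ
      (ofHom (Ctx.fst X.ctx Y.ctx) θ.2.1) (ofHom (Ctx.snd X.ctx Y.ctx) θ.2.2) where
  left := isMap_ofHom _ _
  right := isMap_ofHom _ _
  eq := Subtype.ext (graphTerm_fst_snd θ.1)
  jointly_monic := le_antisymm (meetTerm_graphTerm_le θ.1)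
    (le_meet (isMap_ofHom _ _).1 (isMap_ofHom _ _).1)

instance (C : RgCalc.{u, v}) : UnitaryTabular (IntRel C) where
  exists_isUnit := ⟨_, isUnit_zero C⟩
  exists_isTabulation θ := ⟨_, _, _, isTabulation θ⟩

end IntRel

/-! ### The action of morphisms of regular calculi -/

theorem Ctx.mem_map_sum_iff {T T' : Type u} (F : T → T') (Γ Δ : Ctx T) (t : T') :
    (∃ s ∈ (sum Γ Δ).supp, F s = t) ↔ t ∈ (sum (map F Γ) (map F Δ)).supp := by
  rw [← map_sum, mem_map_supp]

namespace RgCalc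

open Functor.LaxMonoidal

variable {C D E : RgCalc.{u, v}}

theorem act_eqToHom_refl {X : RelCtx C.T} (h : X = X) (x : C.P.obj X) :
    C.act (eqToHom h) x = x := by
  rw [eqToHom_refl, act_id]

theorem act_eqToHom_trans {X Y Z : RelCtx C.T} (h : X = Y) (k : Y = Z) (x : C.P.obj X) :
    C.act (eqToHom k) (C.act (eqToHom h) x) = C.act (eqToHom (h.trans k)) x := by
  rw [← act_comp, eqToHom_trans]

/-- A change of types commutes with sums of contexts only up to a propositional equality, so
predicates are transported along `eqToHom`; transports must therefore pass through juxtaposition. -/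
theorem act_eqToHom_juxt {X X' Y Y' : RelCtx C.T} (h : X = X') (k : Y = Y')
    (e : X ⊗ Y = X' ⊗ Y') (x : C.P.obj X) (y : C.P.obj Y) :
    C.act (eqToHom e) (C.juxt x y) = C.juxt (C.act (eqToHom h) x) (C.act (eqToHom k) y) := by
  subst h k
  simp only [act_eqToHom_refl]

variable (f : C ⟶ D)

/-- The components `F♯_Γ : P(Γ) ⟶ P'(F̄ Γ)` of a morphism of regular calculi. -/
noncomputable def onPred {X : RelCtx C.T} (x : C.P.obj X) : D.P.obj ((RelCtx.mapFunctor f.fn).obj X) :=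
  (f.nat.app X).hom x

theorem onPred_mono {X : RelCtx C.T} {x y : C.P.obj X} (h : x ≤ y) : onPred f x ≤ onPred f y :=
  (f.nat.app X).hom.monotone h

theorem onPred_act {X Y : RelCtx C.T} (A : X ⟶ Y) (x : C.P.obj X) :
    onPred f (C.act A x) = D.act ((RelCtx.mapFunctor f.fn).map A) (onPred f x) :=
  congrArg (fun g => g.hom x) (f.nat.naturality A)

theorem onPred_juxt {X Y : RelCtx C.T} (x : C.P.obj X) (y : C.P.obj Y) :
    onPred f (C.juxt x y) =
      D.act (eqToHom (RelCtx.mapFunctor_tensor f.fn X Y)) (D.juxt (onPred f x) (onPred f y)) := by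
  have h := NatTrans.IsMonoidal.tensor (τ := f.nat) X Y
  rw [Functor.LaxMonoidal.comp_μ, RelCtx.mapFunctor_μ] at h
  exact congrArg (fun g => g.hom (x, y)) h

theorem onPred_star :
    onPred f C.star = D.act (eqToHom (RelCtx.mapFunctor_unit f.fn)) D.star := by
  have h := NatTrans.IsMonoidal.unit (τ := f.nat)
  rw [Functor.LaxMonoidal.comp_ε, RelCtx.mapFunctor_ε] at h
  exact congrArg (fun g => g.hom PUnit.unit) h

/-- `F♯` commutes with the action of relations that are given by the same diagram in `C` and
in `D`. -/
theorem act_onPred_act {X Y : RelCtx C.T} {X' Y' : RelCtx D.T} (A : X ⟶ Y) (B : X' ⟶ Y')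
    (h : (RelCtx.mapFunctor f.fn).obj X = X') (k : (RelCtx.mapFunctor f.fn).obj Y = Y')
    (hs : ∀ t, t ∈ (Ctx.relMap f.fn A).supp ↔ t ∈ Ctx.SubObj.supp B)
    (hr : ∀ i j, (Ctx.relMap f.fn A).rel i j ↔
      Ctx.SubObj.rel B (Fin.cast (by rw [← h, ← k]; rfl) i) (Fin.cast (by rw [← h, ← k]; rfl) j))
    (x : C.P.obj X) :
    D.act (eqToHom k) (onPred f (C.act A x)) = D.act B (D.act (eqToHom h) (onPred f x)) := by
  -- Naturality of `F♯` moves the relation to `D`. The two composites with a transport then agree as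
  -- relations, since they have the same support and identify the same ports.
  rw [onPred_act, ← act_comp, ← act_comp]
  exact congrArg (fun R => D.act R (onPred f x)) (RelCtx.eqToHom_square h k _ B hs hr)

variable {Γ Δ Θ : Ctx C.T}

theorem onTerm_mono {θ θ' : C.P.obj ⟨Ctx.sum Γ Δ⟩} (h : θ ≤ θ') : onTerm f θ ≤ onTerm f θ' :=
  D.act_mono le_rfl (onPred_mono f h)

/-- The diagonals before and after the change of types identify the same ports by definition, so
only the supports need comparison. The other operations on terms are treated alike. -/
theorem onTerm_idTerm (φ : C.P.obj ⟨Γ⟩) :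
    onTerm f (C.idTerm φ) = D.idTerm (onPred f φ) := by
  refine (act_onPred_act f (X := ⟨Γ⟩) (Y := ⟨Ctx.sum Γ Γ⟩) (X' := ⟨Ctx.map f.fn Γ⟩)
    (Y' := ⟨Ctx.sum (Ctx.map f.fn Γ) (Ctx.map f.fn Γ)⟩) (Ctx.graph (Ctx.diag Γ))
    (Ctx.graph (Ctx.diag (Ctx.map f.fn Γ))) rfl (RelCtx.mapFunctor_tensor f.fn ⟨Γ⟩ ⟨Γ⟩).symm
    (fun t => ?_) (fun _ _ => Iff.rfl) φ).trans ?_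
  · simp only [Ctx.mem_relMap_supp, Ctx.graph_supp, Ctx.mem_map_supp]
  · exact congrArg (D.act _) (act_eqToHom_refl _ _)

/-- Monoidality of `F♯` gives the juxtaposition up to one transport, which combines with the given
one and is then distributed over the two factors. -/
theorem act_onPred_juxt {Λ : Ctx C.T} (θ : C.P.obj ⟨Ctx.sum Γ Δ⟩) (θ' : C.P.obj ⟨Ctx.sum Θ Λ⟩)
    (h : (RelCtx.mapFunctor f.fn).obj ⟨Ctx.sum (Ctx.sum Γ Δ) (Ctx.sum Θ Λ)⟩ =
      ⟨Ctx.sum (Ctx.sum (Ctx.map f.fn Γ) (Ctx.map f.fn Δ))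
        (Ctx.sum (Ctx.map f.fn Θ) (Ctx.map f.fn Λ))⟩) :
    D.act (eqToHom h) (onPred f (C.juxt θ θ')) = D.juxt (onTerm f θ) (onTerm f θ') := by
  refine (congrArg (D.act _)
    (onPred_juxt f (X := ⟨Ctx.sum Γ Δ⟩) (Y := ⟨Ctx.sum Θ Λ⟩) θ θ')).trans ?_
  refine (act_eqToHom_trans _ _ _).trans ?_
  exact act_eqToHom_juxt (RelCtx.mapFunctor_tensor f.fn ⟨Γ⟩ ⟨Δ⟩).symm
    (RelCtx.mapFunctor_tensor f.fn ⟨Θ⟩ ⟨Λ⟩).symm _ _ _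

theorem map_sum_sum {T T' : Type u} (F : T → T') (Γ Δ Θ Λ : Ctx T) :
    (RelCtx.mapFunctor F).obj ⟨Ctx.sum (Ctx.sum Γ Δ) (Ctx.sum Θ Λ)⟩ =
      ⟨Ctx.sum (Ctx.sum (Ctx.map F Γ) (Ctx.map F Δ)) (Ctx.sum (Ctx.map F Θ) (Ctx.map F Λ))⟩ :=
  RelCtx.ext (by
    change Ctx.map F (Ctx.sum _ _) = _
    simp only [Ctx.map_sum])

theorem onTerm_compTerm (θ : C.P.obj ⟨Ctx.sum Γ Δ⟩) (θ' : C.P.obj ⟨Ctx.sum Δ Θ⟩) :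
    onTerm f (C.compTerm θ θ') = D.compTerm (onTerm f θ) (onTerm f θ') := by
  refine (act_onPred_act f (X := ⟨Ctx.sum (Ctx.sum Γ Δ) (Ctx.sum Δ Θ)⟩) (Y := ⟨Ctx.sum Γ Θ⟩)
    (Ctx.compRel Γ Δ Θ) (Ctx.compRel (Ctx.map f.fn Γ) (Ctx.map f.fn Δ) (Ctx.map f.fn Θ))
    (map_sum_sum f.fn Γ Δ Δ Θ) (RelCtx.mapFunctor_tensor f.fn ⟨Γ⟩ ⟨Θ⟩).symm
    (fun t => ?_) (fun _ _ => Iff.rfl) _).trans ?_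
  · simp only [Ctx.mem_relMap_supp, Ctx.compRel_supp, Ctx.mem_map_supp]
    grind
  · exact congrArg (D.act _) (act_onPred_juxt f θ θ' _)

theorem onTerm_dagTerm (θ : C.P.obj ⟨Ctx.sum Γ Δ⟩) :
    onTerm f (dagTerm θ) = dagTerm (onTerm f θ) := by
  refine act_onPred_act f (X := ⟨Ctx.sum Γ Δ⟩) (Y := ⟨Ctx.sum Δ Γ⟩)
    (Ctx.graph (Ctx.swapIso Γ Δ).hom)
    (Ctx.graph (Ctx.swapIso (Ctx.map f.fn Γ) (Ctx.map f.fn Δ)).hom)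
    (RelCtx.mapFunctor_tensor f.fn ⟨Γ⟩ ⟨Δ⟩).symm (RelCtx.mapFunctor_tensor f.fn ⟨Δ⟩ ⟨Γ⟩).symm
    (fun t => ?_) (fun _ _ => Iff.rfl) θ
  exact (Ctx.mem_relMap_supp _ _ t).trans (Ctx.mem_map_sum_iff f.fn Γ Δ t)

theorem onTerm_meetTerm (θ θ' : C.P.obj ⟨Ctx.sum Γ Δ⟩) :
    onTerm f (meetTerm θ θ') = meetTerm (onTerm f θ) (onTerm f θ') := by
  refine (act_onPred_act f (X := ⟨Ctx.sum (Ctx.sum Γ Δ) (Ctx.sum Γ Δ)⟩) (Y := ⟨Ctx.sum Γ Δ⟩)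
    (Ctx.cograph (Ctx.diag (Ctx.sum Γ Δ)))
    (Ctx.cograph (Ctx.diag (Ctx.sum (Ctx.map f.fn Γ) (Ctx.map f.fn Δ))))
    (map_sum_sum f.fn Γ Δ Γ Δ) (RelCtx.mapFunctor_tensor f.fn ⟨Γ⟩ ⟨Δ⟩).symm
    (fun t => ?_) (fun _ _ => Iff.rfl) _).trans ?_
  · exact (Ctx.mem_relMap_supp _ _ t).trans (Ctx.mem_map_sum_iff f.fn Γ Δ t)
  · exact congrArg (D.act _) (act_onPred_juxt f θ θ' _)

theorem push_fst_onTerm (θ : C.P.obj ⟨Ctx.sum Γ Δ⟩) :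
    D.push (Ctx.fst (Ctx.map f.fn Γ) (Ctx.map f.fn Δ)) (onTerm f θ) =
      onPred f (C.push (Ctx.fst Γ Δ) θ) := by
  refine (act_onPred_act f (X := ⟨Ctx.sum Γ Δ⟩) (Y := ⟨Γ⟩) (Ctx.graph (Ctx.fst Γ Δ))
    (Ctx.graph (Ctx.fst (Ctx.map f.fn Γ) (Ctx.map f.fn Δ)))
    (RelCtx.mapFunctor_tensor f.fn ⟨Γ⟩ ⟨Δ⟩).symm rfl
    (fun t => ?_) (fun _ _ => Iff.rfl) θ).symm.trans (act_eqToHom_refl _ _)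
  exact (Ctx.mem_relMap_supp _ _ t).trans (Ctx.mem_map_sum_iff f.fn Γ Δ t)

theorem push_snd_onTerm (θ : C.P.obj ⟨Ctx.sum Γ Δ⟩) :
    D.push (Ctx.snd (Ctx.map f.fn Γ) (Ctx.map f.fn Δ)) (onTerm f θ) =
      onPred f (C.push (Ctx.snd Γ Δ) θ) := by
  refine (act_onPred_act f (X := ⟨Ctx.sum Γ Δ⟩) (Y := ⟨Δ⟩) (Ctx.graph (Ctx.snd Γ Δ))
    (Ctx.graph (Ctx.snd (Ctx.map f.fn Γ) (Ctx.map f.fn Δ)))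
    (RelCtx.mapFunctor_tensor f.fn ⟨Γ⟩ ⟨Δ⟩).symm rfl
    (fun t => ?_) (fun _ _ => Iff.rfl) θ).symm.trans (act_eqToHom_refl _ _)
  exact (Ctx.mem_relMap_supp _ _ t).trans (Ctx.mem_map_sum_iff f.fn Γ Δ t)

theorem isIntRel_onTerm {φ : C.P.obj ⟨Γ⟩} {ψ : C.P.obj ⟨Δ⟩} {θ : C.P.obj ⟨Ctx.sum Γ Δ⟩}
    (h : C.IsIntRel φ ψ θ) : D.IsIntRel (onPred f φ) (onPred f ψ) (onTerm f θ) :=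
  ⟨(push_fst_onTerm f θ).trans_le (onPred_mono f h.1),
    (push_snd_onTerm f θ).trans_le (onPred_mono f h.2)⟩

/-- The functor between the po-categories of internal relations that is induced by a morphism of
regular calculi. -/
noncomputable def intRelFunctor : IntRel C ⥤ IntRel D where
  obj X := ⟨Ctx.map f.fn X.ctx, onPred f X.pred⟩
  map θ := ⟨onTerm f θ.1, isIntRel_onTerm f θ.2⟩
  map_id X := Subtype.ext (onTerm_idTerm f X.pred)
  map_comp θ θ' := Subtype.ext (onTerm_compTerm f θ.1 θ'.1)

/-- The contexts are compared inside `RelCtx` so that the predicates can be related by the action of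
an `eqToHom`. -/
theorem intRel_mk_eq_mk {Γ Γ' : Ctx C.T} {φ : C.P.obj ⟨Γ⟩} {φ' : C.P.obj ⟨Γ'⟩}
    (h : RelCtx.mk Γ = RelCtx.mk Γ') (h' : φ' = C.act (eqToHom h) φ) :
    (⟨Γ, φ⟩ : IntRel C) = ⟨Γ', φ'⟩ := by
  cases h
  rw [h', act_eqToHom_refl]

theorem isUnitaryFunctor_intRelFunctor : IsUnitaryFunctor (intRelFunctor f) where
  map_mono h := onTerm_mono f h
  map_dag θ := Subtype.ext (onTerm_dagTerm f θ.1)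
  map_meet θ θ' := Subtype.ext (onTerm_meetTerm f θ.1 θ'.1)
  exists_isUnit := by
    refine ⟨_, IntRel.isUnit_zero C, ?_⟩
    -- Unit coherence of `F♯` identifies the image of the unit object with the unit object of `D`.
    have : (⟨Ctx.zero D.T, D.star⟩ : IntRel D) =
        (intRelFunctor f).obj ⟨Ctx.zero C.T, C.star⟩ :=
      intRel_mk_eq_mk (RelCtx.mapFunctor_unit f.fn) (onPred_star f)
    rw [← this]
    exact IntRel.isUnit_zero D

end RgCalc

/-! ### The syntactic functor -/

namespace Syn

open RgCalc

variable {C D E : RgCalc.{u, v}}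

theorem regular (C : RgCalc.{u, v}) : Regular (Syn C) := inferInstance

/-- The regular functor between the syntactic categories that is induced by a morphism of regular
calculi. -/
noncomputable def map (f : C ⟶ D) :
    RgCat.of (Syn C) (regular C) ⟶ RgCat.of (Syn D) (regular D) where
  functor := (isUnitaryFunctor_intRelFunctor f).mapLAdj
  preservesFiniteLimits := (isUnitaryFunctor_intRelFunctor f).preservesFiniteLimits
  preservesRegularEpi g hg := (isUnitaryFunctor_intRelFunctor f).map_isRegularEpi g hg

theorem isIntFun_onTerm (f : C ⟶ D) {X Y : Syn C} (θ : X ⟶ Y) :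
    IsIntFun (onObj f X) (onObj f Y) (onTerm f (term θ)) :=
  ⟨((map f).functor.map θ).1.2, ((map f).functor.map θ).2⟩

/-- Morphisms of `Syn C` are determined by their terms, so a heterogeneous equality reduces to one
transport of predicates. This is what functoriality needs, since objects agree only propositionally.
-/
theorem hom_heq {X X' Y Y' : Syn C} (hX : X = X') (hY : Y = Y') {θ : X ⟶ Y} {θ' : X' ⟶ Y'}
    {h : RelCtx.mk (Ctx.sum X'.obj.ctx Y'.obj.ctx) = RelCtx.mk (Ctx.sum X.obj.ctx Y.obj.ctx)}
    (e : term θ = C.act (eqToHom h) (term θ')) : HEq θ θ' := by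
  subst hX hY
  rw [act_eqToHom_refl] at e
  exact heq_of_eq (Subtype.ext (Subtype.ext e))

theorem map_id (C : RgCalc.{u, v}) : map (𝟙 C) = 𝟙 (RgCat.of (Syn C) (regular C)) := by
  have hobj (X : Syn C) : onObj (𝟙 C) X = X :=
    congrArg LAdj.mk (intRel_mk_eq_mk (RelCtx.mapFunctor_id ⟨X.obj.ctx⟩) rfl).symm
  refine RgCat.Hom.ext (Functor.hext hobj fun X Y θ => ?_)
  refine hom_heq (C := C) (hobj X) (hobj Y) (θ := (map (𝟙 C)).functor.map θ) (θ' := θ)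
    (h := ?_) ?_
  · exact (RelCtx.mapFunctor_id ⟨Ctx.sum X.obj.ctx Y.obj.ctx⟩).trans
      (RelCtx.mapFunctor_tensor id ⟨X.obj.ctx⟩ ⟨Y.obj.ctx⟩).symm
  -- The identity of `RgCalc` acts on predicates by transport, so both sides are transports of the
  -- same term and proof irrelevance makes them agree.
  · exact act_eqToHom_trans (RelCtx.mapFunctor_id ⟨Ctx.sum X.obj.ctx Y.obj.ctx⟩) _ (term θ)

theorem map_comp (f : C ⟶ D) (g : D ⟶ E) : map (f ≫ g) = map f ≫ map g := by
  have hobj (X : Syn C) : onObj (f ≫ g) X = onObj g (onObj f X) :=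
    congrArg LAdj.mk (intRel_mk_eq_mk (RelCtx.mapFunctor_comp f.fn g.fn ⟨X.obj.ctx⟩) rfl).symm
  refine RgCat.Hom.ext (Functor.hext hobj fun X Y θ => ?_)
  refine hom_heq (C := E) (hobj X) (hobj Y) (θ := (map (f ≫ g)).functor.map θ)
    (θ' := (map g).functor.map ((map f).functor.map θ)) (h := ?_) ?_
  · refine RelCtx.ext ?_
    change Ctx.sum (Ctx.map g.fn (Ctx.map f.fn _)) (Ctx.map g.fn (Ctx.map f.fn _)) =
      Ctx.sum (Ctx.map (g.fn ∘ f.fn) _) (Ctx.map (g.fn ∘ f.fn) _)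
    rw [Ctx.map_map, Ctx.map_map]
  -- The transport inside `onTerm f` is moved out past `F♯` of `g` by naturality. Both sides then
  -- become iterated transports of `onPred g (onPred f (term θ))`, which collapse to a single one.
  · have h₁ : onTerm g (onTerm f (term θ)) = E.act (eqToHom _) (E.act (eqToHom _)
        (onPred g (onPred f (term θ)))) := congrArg (E.act _) ((onPred_act g _ _).trans
          (congrArg (fun A => E.act A (onPred g (onPred f (term θ)))) (eqToHom_map _ _)))
    refine Eq.trans ?_ (congrArg (E.act _) h₁).symm
    refine (act_eqToHom_trans _ _ _).trans ?_
    exact ((act_eqToHom_trans _ _ _).trans (act_eqToHom_trans _ _ _)).symm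

end Syn

end GRL

theorem theorem8p1 :
    ∃ (regular : ∀ C : RgCalc.{u, v}, Regular (Syn C))
      (isIntFun : ∀ {C D : RgCalc.{u, v}} (f : C ⟶ D) {X Y : Syn C} (θ : X ⟶ Y),
        Syn.IsIntFun (RgCalc.onObj f X) (RgCalc.onObj f Y) (RgCalc.onTerm f (Syn.term θ)))
      (synMap : ∀ {C D : RgCalc.{u, v}}, (C ⟶ D) →
        (RgCat.of (Syn C) (regular C) ⟶ RgCat.of (Syn D) (regular D)))
      (syn : RgCalc.{u, v} ⥤ RgCat.{max u v, v}),
      (∀ {C D : RgCalc.{u, v}} (f : C ⟶ D), (synMap f).functor.toPrefunctor =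
        { obj := fun X => RgCalc.onObj f X
          map := fun θ => Syn.ofTerm (isIntFun f θ) }) ∧
      syn.toPrefunctor =
        { obj := fun C => RgCat.of (Syn C) (regular C)
          map := fun f => synMap f } :=
  ⟨Syn.regular, Syn.isIntFun_onTerm, Syn.map,
    { obj := fun C => RgCat.of (Syn C) (Syn.regular C)
      map := Syn.map
      map_id := Syn.map_id
      map_comp := Syn.map_comp },
    -- The prescribed assignments on objects and terms are by construction those of `Syn.map`, so
    -- both descriptions hold definitionally.
    fun _ => rfl, rfl⟩
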